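/- Let $Y$ be the complex unit disk with the hyperbolic metric given by the line element $|dz|/(1-|z|^2)$, that is, $d_Y(z,w)=\operatorname{artanh}\left|\frac{z-w}{1-\bar w z}\right|$ (so that $d_Y(0,\tanh R)=R$, and the circle of radius $R$ centered at $0$ has length $\frac{\pi}{2}(e^{2R}-e^{-2R})$). Terminology. A *Gromov hyperbolic space* is a complete, unbounded, locally compact, geodesic metric space for which there is $\delta\ge 0$ such that each side of every geodesic triangle lies in the union of the closed $\delta$-balls centered at the points of the other two sides. For a Gromov hyperbolic space $(X,d)$, a base point $x_0\in X$ and $\varepsilon>0$, the uniformization $X_\varepsilon$ is the set $X$ with the metric $d_\varepsilon(x,y)=\inf_\gamma\int_\gamma e^{-\varepsilon d(\cdot,x_0)}\,ds$, where the infimum is over all rectifiable paths $\gamma$ from $x$ to $y$. A locally complete, non-complete metric space $(W,d)$, with $\partial W=\overline W\setminus W$ ($\overline W$ the completion of $W$), is a *uniform domain* if there is $\lambda\ge1$ such that any $x,y\in W$ are the end points of a curve $\gamma$ in $W$ with $\ell(\gamma)\le\lambda d(x,y)$ and, for every $z\in\gamma$, $\operatorname{dist}(z,\partial W)\ge\lambda^{-1}\min\{\ell(\gamma(x,z)),\ell(\gamma(z,y))\}$,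 for all choices of the subcurve $\gamma(x,z)$ from the start $x$ of $\gamma$ to a visit of $z$ and of the subcurve $\gamma(z,y)$ from a visit of $z$ to the end $y$. A map $\Phi:Y\to X$ is an *$(L,C)$-rough similarity* ($L>0$, $C\ge0$) if $L\,d_Y(x,y)-C\le d_X(\Phi(x),\Phi(y))\le L\,d_Y(x,y)+C$ for all $x,y\in Y$ and the Hausdorff distance between $\Phi(Y)$ and $X$ is at most $C$. Then, with base point $0$ in all uniformizations of the disk: 1. $Y$ is Gromov hyperbolic, and there is $\varepsilon_1>0$ such that $Y_{\varepsilon_1}$ is a uniform domain. 2. For every $\varepsilon>2$, $Y_\varepsilon$ is not a uniform domain. 3. Let $\varepsilon>2$, let $\varepsilon_1>0$ be any number such that $Y_{\varepsilon_1}$ is a uniform domain, and let $Z$ be the same disk with the scaled metric $d_Z=\frac{\varepsilon_1}{\varepsilon}d_Y$. Then $Z$ is Gromov hyperbolic; $Z_\varepsilon$ is $Y_{\varepsilon_1}$ with its metric multiplied by the constant $\frac{\varepsilon_1}{\varepsilon}$; $Z_\varepsilon$ is a uniform domain; and the identity map $Y\to Z$ is an $(\frac{\varepsilon_1}{\varepsilon},0)$-rough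 similarity. Consequently the following assertion is false: whenever $X$ and $Y$ are Gromov hyperbolic spaces, $\Phi:Y\to X$ is an $(L,C)$-rough similarity for some $L>0$ and $C\ge0$, $y_0\in Y$, $\varepsilon>0$, and $X_\varepsilon$ with base point $\Phi(y_0)$ is a uniform domain, then $Y_\varepsilon$ with base point $y_0$ is a uniform domain. (For $L=1$, in particular for rough isometries, this assertion is the theorem that the example shows cannot be extended.) -/

import Mathlib

open Set Topology

/-! ### Geodesics and Gromov hyperbolic spaces -/

/-- `γ`, restricted to `[0, dist x y]`, is a geodesic path from `x` to `y`
(an isometric embedding of that interval). -/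
def IsGeodesicPath {X : Type*} [MetricSpace X] (γ : ℝ → X) (x y : X) : Prop :=
  γ 0 = x ∧ γ (dist x y) = y ∧
    ∀ s ∈ Icc 0 (dist x y), ∀ t ∈ Icc 0 (dist x y), dist (γ s) (γ t) = |s - t|

/-- `S` is the trace `[x, y]` of a geodesic path with end points `x` and `y`. -/
def IsGeodesicSegment {X : Type*} [MetricSpace X] (S : Set X) (x y : X) : Prop :=
  ∃ γ : ℝ → X, IsGeodesicPath γ x y ∧ S = γ '' Icc 0 (dist x y)

/-- A Gromov hyperbolic space: a complete, unbounded, locally compact, geodesic metric space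
all of whose geodesic triangles are `δ`-thin for some fixed `δ ≥ 0`. -/
structure IsGromovHyperbolic (X : Type*) [MetricSpace X] : Prop where
  complete : CompleteSpace X
  unbounded : ¬ Bornology.IsBounded (univ : Set X)
  locallyCompact : LocallyCompactSpace X
  geodesic : ∀ x y : X, ∃ γ : ℝ → X, IsGeodesicPath γ x y
  thin : ∃ δ : ℝ, 0 ≤ δ ∧ ∀ (x y z : X) (Sxy Syz Szx : Set X),
    IsGeodesicSegment Sxy x y → IsGeodesicSegment Syz y z → IsGeodesicSegment Szx z x →
      Sxy ⊆ ⋃ w ∈ Syz ∪ Szx, Metric.closedBall w δ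

/-! ### Uniform domains -/

/-- The boundary `∂Z`: the points of the metric completion of `Z` that are not in `Z`. -/
def metricBoundary (Z : Type*) [MetricSpace Z] : Set (UniformSpace.Completion Z) :=
  (range ((↑) : Z → UniformSpace.Completion Z))ᶜ

/-- The distance `δ_Z(z)` from `z` to the boundary `∂Z`, measured in the completion. -/
noncomputable def boundaryDist {Z : Type*} [MetricSpace Z] (z : Z) : ℝ :=
  Metric.infDist (z : UniformSpace.Completion Z) (metricBoundary Z)

/-- `γ` is a `lam`-uniform curve from `x` to `y`; lengths are total variations, with values in
`[0, ∞]`. The first condition makes `γ` rectifiable. In the second one a point `z = γ s = γ t`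
that the curve visits several times is tested against all choices of the subcurves
`γ(x, z) = γ|[0, s]` and `γ(z, y) = γ|[t, 1]`. -/
def IsUniformCurve {Z : Type*} [MetricSpace Z] (lam : ℝ) {x y : Z} (γ : Path x y) : Prop :=
  eVariationOn γ univ ≤ ENNReal.ofReal (lam * dist x y) ∧
    ∀ s t : unitInterval, γ s = γ t →
      ENNReal.ofReal lam⁻¹ * min (eVariationOn γ (Iic s)) (eVariationOn γ (Ici t)) ≤
        ENNReal.ofReal (boundaryDist (γ s))

/-- A uniform domain: a locally complete, non-complete metric space in which, for some constant
`lam ≥ 1`, any two points are joined by a `lam`-uniform curve. -/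
structure IsUniformDomain (Z : Type*) [MetricSpace Z] : Prop where
  locallyComplete : ∀ z : Z, ∃ U ∈ 𝓝 z, IsComplete U
  notComplete : ¬ CompleteSpace Z
  uniform : ∃ lam : ℝ, 1 ≤ lam ∧ ∀ x y : Z, ∃ γ : Path x y, IsUniformCurve lam γ

/-! ### Uniformization -/

/-- The density `ρ_ε(z) = exp (-ε d(z, z₀))`. -/
noncomputable def uniformizationDensity {X : Type*} [MetricSpace X] (z₀ : X) (ε : ℝ) (z : X) : ℝ :=
  Real.exp (-ε * dist z z₀)

/-- The values `∫_γ ρ_ε ds`, where `γ` runs over the rectifiable paths from `x` to `y`. As usual,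
a rectifiable path of length `L` is parametrized by arc length, `γ : [0, L] → X`, and its integral
against the arc-length measure is `∫₀ᴸ ρ_ε (γ t) dt`. -/
def weightedLengths {X : Type*} [MetricSpace X] (z₀ : X) (ε : ℝ) (x y : X) : Set ℝ :=
  {s | ∃ (L : ℝ) (γ : ℝ → X), 0 ≤ L ∧ HasUnitSpeedOn γ (Icc 0 L) ∧ γ 0 = x ∧ γ L = y ∧
    s = ∫ t in (0 : ℝ)..L, uniformizationDensity z₀ ε (γ t)}

/-- The uniformized distance `d_ε(x, y) = inf_γ ∫_γ ρ_ε ds`. -/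
noncomputable def uniformizedDist {X : Type*} [MetricSpace X] (z₀ : X) (ε : ℝ) (x y : X) : ℝ :=
  sInf (weightedLengths z₀ ε x y)

section UniformizedDist

variable {X : Type*} [MetricSpace X]

lemma IsGeodesicPath.hasUnitSpeedOn {γ : ℝ → X} {x y : X} (h : IsGeodesicPath γ x y) :
    HasUnitSpeedOn γ (Icc 0 (dist x y)) := by
  unfold HasUnitSpeedOn
  rw [hasConstantSpeedOnWith_iff_ordered]
  intro s hs t ht hst
  have hsub : Icc 0 (dist x y) ∩ Icc s t ⊆ Icc 0 (dist x y) := inter_subset_left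
  have hs' : s ∈ Icc 0 (dist x y) ∩ Icc s t := ⟨hs, le_rfl, hst⟩
  have ht' : t ∈ Icc 0 (dist x y) ∩ Icc s t := ⟨ht, hst, le_rfl⟩
  have hl : LipschitzOnWith 1 γ (Icc 0 (dist x y)) := by
    refine LipschitzOnWith.of_dist_le_mul fun a ha b hb => ?_
    rw [h.2.2 a ha b hb, Real.dist_eq]; simp
  apply le_antisymm
  · have h1 := (hl.mono hsub).comp_eVariationOn_le (g := (id : ℝ → ℝ))
      (s := Icc 0 (dist x y) ∩ Icc s t) (fun a ha => ha)
    have h2 := ((monotone_id (α := ℝ)).monotoneOn (Icc 0 (dist x y))).eVariationOn_eq hs ht |>.le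
    simpa using h1.trans (mul_le_mul_right h2 _)
  · have h3 := eVariationOn.edist_le γ hs' ht'
    rw [edist_dist, h.2.2 s hs t ht, abs_sub_comm, abs_of_nonneg (sub_nonneg.2 hst)] at h3
    simpa using h3

lemma HasUnitSpeedOn.dist_le {γ : ℝ → X} {L s t : ℝ} (h : HasUnitSpeedOn γ (Icc 0 L))
    (hs : s ∈ Icc 0 L) (ht : t ∈ Icc 0 L) (hst : s ≤ t) : dist (γ s) (γ t) ≤ t - s := by
  have h1 := h hs ht
  have h3 := eVariationOn.edist_le γ (s := Icc 0 L ∩ Icc s t) ⟨hs, le_rfl, hst⟩ ⟨ht, hst, le_rfl⟩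
  rw [h1, edist_dist] at h3
  have h4 := (ENNReal.ofReal_le_ofReal_iff (by simpa using hst)).1 h3
  simpa using h4

lemma HasUnitSpeedOn.continuousOn_Icc {γ : ℝ → X} {L : ℝ} (h : HasUnitSpeedOn γ (Icc 0 L)) :
    ContinuousOn γ (Icc 0 L) := by
  refine LipschitzOnWith.continuousOn (K := 1) (LipschitzOnWith.of_dist_le_mul ?_)
  intro a ha b hb
  rw [NNReal.coe_one, one_mul]
  rcases le_total a b with hab | hab
  · rw [dist_comm a b, Real.dist_eq, abs_of_nonneg (sub_nonneg.2 hab)]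
    exact h.dist_le ha hb hab
  · rw [Real.dist_eq, abs_of_nonneg (sub_nonneg.2 hab), dist_comm]
    exact h.dist_le hb ha hab

lemma continuous_uniformizationDensity (z₀ : X) (ε : ℝ) :
    Continuous (uniformizationDensity z₀ ε) := by
  unfold uniformizationDensity; fun_prop

lemma weightedLengths_nonneg {z₀ x y : X} {ε s : ℝ} (hs : s ∈ weightedLengths z₀ ε x y) :
    0 ≤ s := by
  obtain ⟨L, γ, hL, -, -, -, rfl⟩ := hs
  exact intervalIntegral.integral_nonneg hL fun t _ => (Real.exp_pos _).le

lemma bddBelow_weightedLengths (z₀ x y : X) (ε : ℝ) : BddBelow (weightedLengths z₀ ε x y) :=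
  ⟨0, fun _ hs => weightedLengths_nonneg hs⟩

lemma zero_mem_weightedLengths (z₀ x : X) (ε : ℝ) : (0 : ℝ) ∈ weightedLengths z₀ ε x x :=
  ⟨0, fun _ => x, le_rfl, hasConstantSpeedOnWith_of_subsingleton _ (by simp) _, rfl, rfl, by simp⟩

lemma weightedLengths_symm {z₀ x y : X} {ε s : ℝ} (hs : s ∈ weightedLengths z₀ ε x y) :
    s ∈ weightedLengths z₀ ε y x := by
  obtain ⟨L, γ, hL, hγ, h0, h1, rfl⟩ := hs
  refine ⟨L, fun t => γ (L - t), hL, ?_, by simpa using h1, by simpa using h0, ?_⟩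
  · unfold HasUnitSpeedOn
    rw [hasConstantSpeedOnWith_iff_ordered]
    intro a ha b hb hab
    have ha' : L - a ∈ Icc 0 L := ⟨by linarith [ha.2], by linarith [ha.1]⟩
    have hb' : L - b ∈ Icc 0 L := ⟨by linarith [hb.2], by linarith [hb.1]⟩
    have h2 := eVariationOn.comp_eq_of_antitoneOn γ (t := Icc 0 L ∩ Icc a b) (fun t => L - t)
      (fun p _ q _ hpq => by simp only; linarith)
    have h3 : (fun t => L - t) '' (Icc 0 L ∩ Icc a b) = Icc 0 L ∩ Icc (L - b) (L - a) := by
      ext u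
      constructor
      · rintro ⟨v, ⟨⟨hv1, hv2⟩, hv3, hv4⟩, rfl⟩
        refine ⟨⟨?_, ?_⟩, ?_, ?_⟩ <;> simp only <;> linarith
      · rintro ⟨⟨hv1, hv2⟩, hv3, hv4⟩
        refine ⟨L - u, ⟨⟨?_, ?_⟩, ?_, ?_⟩, ?_⟩ <;> (try simp only) <;> linarith
    rw [h3, hγ hb' ha'] at h2
    refine h2.trans ?_
    congr 2
    ring
  · simpa using (intervalIntegral.integral_comp_sub_left
      (fun t => uniformizationDensity z₀ ε (γ t)) L (a := 0) (b := L)).symm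

lemma weightedLengths_add {z₀ x y z : X} {ε s t : ℝ} (hs : s ∈ weightedLengths z₀ ε x y)
    (ht : t ∈ weightedLengths z₀ ε y z) : s + t ∈ weightedLengths z₀ ε x z := by
  obtain ⟨L, γ, hL, hγ, h0, h1, rfl⟩ := hs
  obtain ⟨M, η, hM, hη, k0, k1, rfl⟩ := ht
  set σ : ℝ → X := fun t => if t ≤ L then γ t else η (t - L) with hσ
  have e1 : EqOn σ γ (Icc 0 L) := fun t ht => by simp [hσ, ht.2]
  have e2 : EqOn σ (fun t => η (t - L)) (Icc L (L + M)) := fun t ht => by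
    rcases eq_or_lt_of_le ht.1 with h | h
    · subst h; simp [hσ, h1, k0]
    · simp [hσ, not_le.2 h]
  have u1 : HasUnitSpeedOn σ (Icc 0 L) := fun a ha b hb => by
    rw [eVariationOn.eq_of_eqOn (e1.mono inter_subset_left)]; exact hγ ha hb
  have u2 : HasUnitSpeedOn σ (Icc L (L + M)) := by
    intro a ha b hb
    rw [eVariationOn.eq_of_eqOn (e2.mono inter_subset_left)]
    have ha' : a - L ∈ Icc 0 M := ⟨by linarith [ha.1], by linarith [ha.2]⟩
    have hb' : b - L ∈ Icc 0 M := ⟨by linarith [hb.1], by linarith [hb.2]⟩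
    have h2 := eVariationOn.comp_eq_of_monotoneOn η (t := Icc L (L + M) ∩ Icc a b)
      (fun t => t - L) (fun p _ q _ hpq => by simpa using hpq)
    have h3 : (fun t => t - L) '' (Icc L (L + M) ∩ Icc a b) =
        Icc 0 M ∩ Icc (a - L) (b - L) := by
      ext u
      constructor
      · rintro ⟨v, ⟨⟨hv1, hv2⟩, hv3, hv4⟩, rfl⟩
        refine ⟨⟨?_, ?_⟩, ?_, ?_⟩ <;> simp only <;> linarith
      · rintro ⟨⟨hv1, hv2⟩, hv3, hv4⟩
        refine ⟨u + L, ⟨⟨?_, ?_⟩, ?_, ?_⟩, ?_⟩ <;> (try simp only) <;> linarith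
    rw [h3, hη ha' hb'] at h2
    refine h2.trans ?_
    congr 2
    ring
  have u : HasUnitSpeedOn σ (Icc 0 (L + M)) := u1.Icc_Icc u2
  have hc : ContinuousOn (fun t => uniformizationDensity z₀ ε (σ t)) (Icc 0 (L + M)) :=
    (continuous_uniformizationDensity z₀ ε).comp_continuousOn u.continuousOn_Icc
  refine ⟨L + M, σ, by positivity, u, ?_, ?_, ?_⟩
  · rw [e1 ⟨le_rfl, hL⟩, h0]
  · rw [e2 ⟨by linarith, le_rfl⟩]; simpa using k1
  · have i1 : IntervalIntegrable (fun t => uniformizationDensity z₀ ε (σ t))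
        MeasureTheory.volume 0 L := by
      refine ContinuousOn.intervalIntegrable ?_
      rw [uIcc_of_le hL]
      exact hc.mono (Icc_subset_Icc le_rfl (by linarith))
    have i2 : IntervalIntegrable (fun t => uniformizationDensity z₀ ε (σ t))
        MeasureTheory.volume L (L + M) := by
      refine ContinuousOn.intervalIntegrable ?_
      rw [uIcc_of_le (by linarith)]
      exact hc.mono (Icc_subset_Icc hL le_rfl)
    rw [← intervalIntegral.integral_add_adjacent_intervals i1 i2]
    congr 1
    · refine intervalIntegral.integral_congr fun t ht => ?_
      rw [uIcc_of_le hL] at ht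
      simp only [e1 ht]
    · have h5 := intervalIntegral.integral_comp_sub_right
        (fun t => uniformizationDensity z₀ ε (η t)) L (a := L) (b := L + M)
      simp only [sub_self, add_sub_cancel_left] at h5
      rw [← h5]
      refine intervalIntegral.integral_congr fun t ht => ?_
      rw [uIcc_of_le (by linarith)] at ht
      simp only [e2 ht]

lemma le_of_mem_weightedLengths {z₀ x y : X} {ε s : ℝ} (hs : s ∈ weightedLengths z₀ ε x y) :
    dist x y * Real.exp (-(|ε| * (dist x z₀ + dist x y))) ≤ s := by
  obtain ⟨L, γ, hL, hγ, h0, h1, rfl⟩ := hs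
  have hDL : dist x y ≤ L := by
    have := hγ.dist_le ⟨le_rfl, hL⟩ ⟨hL, le_rfl⟩ hL
    rw [h0, h1] at this; linarith
  have hD : 0 ≤ dist x y := dist_nonneg
  have hc : ContinuousOn (fun t => uniformizationDensity z₀ ε (γ t)) (Icc 0 L) :=
    (continuous_uniformizationDensity z₀ ε).comp_continuousOn hγ.continuousOn_Icc
  have i1 : IntervalIntegrable (fun t => uniformizationDensity z₀ ε (γ t))
      MeasureTheory.volume 0 (dist x y) := by
    refine ContinuousOn.intervalIntegrable ?_
    rw [uIcc_of_le hD]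
    exact hc.mono (Icc_subset_Icc le_rfl hDL)
  have i2 : IntervalIntegrable (fun t => uniformizationDensity z₀ ε (γ t))
      MeasureTheory.volume (dist x y) L := by
    refine ContinuousOn.intervalIntegrable ?_
    rw [uIcc_of_le hDL]
    exact hc.mono (Icc_subset_Icc hD le_rfl)
  rw [← intervalIntegral.integral_add_adjacent_intervals i1 i2]
  have p2 : 0 ≤ ∫ t in (dist x y)..L, uniformizationDensity z₀ ε (γ t) :=
    intervalIntegral.integral_nonneg hDL fun t _ => (Real.exp_pos _).le
  have p1 : ∫ _ in (0 : ℝ)..(dist x y), Real.exp (-(|ε| * (dist x z₀ + dist x y))) ≤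
      ∫ t in (0 : ℝ)..(dist x y), uniformizationDensity z₀ ε (γ t) := by
    refine intervalIntegral.integral_mono_on hD (by simp) i1 fun t ht => ?_
    refine Real.exp_le_exp.2 ?_
    have q1 : dist (γ t) z₀ ≤ dist x z₀ + dist x y := by
      have q2 := hγ.dist_le ⟨le_rfl, hL⟩ ⟨ht.1, ht.2.trans hDL⟩ ht.1
      rw [h0] at q2
      have q3 := dist_triangle (γ t) x z₀
      rw [dist_comm (γ t) x] at q3
      linarith [ht.2]
    have q4 : ε * dist (γ t) z₀ ≤ |ε| * (dist x z₀ + dist x y) :=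
      (mul_le_mul_of_nonneg_right (le_abs_self ε) dist_nonneg).trans
        (mul_le_mul_of_nonneg_left q1 (abs_nonneg ε))
    linarith
  simp only [intervalIntegral.integral_const, sub_zero, smul_eq_mul] at p1
  linarith

lemma IsGromovHyperbolic.weightedLengths_nonempty (hX : IsGromovHyperbolic X) (z₀ x y : X)
    (ε : ℝ) : (weightedLengths z₀ ε x y).Nonempty := by
  obtain ⟨γ, hγ⟩ := hX.geodesic x y
  exact ⟨_, dist x y, γ, dist_nonneg, hγ.hasUnitSpeedOn, hγ.1, hγ.2.1, rfl⟩

end UniformizedDist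

/-- The uniformization `X_ε` of the Gromov hyperbolic space `X` with base point `z₀`: the set `X`,
to be equipped with the metric `d_ε`. -/
@[ext, nolint unusedArguments]
structure Uniformization {X : Type*} [MetricSpace X] (_hX : IsGromovHyperbolic X) (_z₀ : X)
    (_ε : ℝ) where
  /-- The underlying point of `X`. -/
  point : X

noncomputable instance {X : Type*} [MetricSpace X] (hX : IsGromovHyperbolic X) (z₀ : X) (ε : ℝ) :
    MetricSpace (Uniformization hX z₀ ε) where
  dist x y := uniformizedDist z₀ ε x.point y.point
  dist_self x := le_antisymm
    (csInf_le (bddBelow_weightedLengths z₀ x.point x.point ε)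
      (zero_mem_weightedLengths z₀ x.point ε))
    (Real.sInf_nonneg fun _ hs => weightedLengths_nonneg hs)
  dist_comm x y := congrArg sInf
    (Subset.antisymm (fun _ hs => weightedLengths_symm hs) (fun _ hs => weightedLengths_symm hs))
  dist_triangle x y z := by
    refine le_of_forall_pos_le_add fun η hη => ?_
    obtain ⟨s, hs, hs'⟩ := exists_lt_of_csInf_lt
      (hX.weightedLengths_nonempty z₀ x.point y.point ε)
      (lt_add_of_pos_right (uniformizedDist z₀ ε x.point y.point) (half_pos hη))
    obtain ⟨t, ht, ht'⟩ := exists_lt_of_csInf_lt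
      (hX.weightedLengths_nonempty z₀ y.point z.point ε)
      (lt_add_of_pos_right (uniformizedDist z₀ ε y.point z.point) (half_pos hη))
    have h := csInf_le (bddBelow_weightedLengths z₀ x.point z.point ε) (weightedLengths_add hs ht)
    change uniformizedDist z₀ ε x.point z.point ≤ _ at h
    linarith
  eq_of_dist_eq_zero := by
    intro x y hxy
    by_contra hne
    have hpos : 0 < dist x.point y.point :=
      dist_pos.2 fun h => hne (Uniformization.ext h)
    have h := le_csInf (hX.weightedLengths_nonempty z₀ x.point y.point ε)
      (fun s hs => le_of_mem_weightedLengths hs)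
    have h' : 0 < dist x.point y.point *
        Real.exp (-(|ε| * (dist x.point z₀ + dist x.point y.point))) := by positivity
    exact absurd (h'.trans_le h) (not_lt.2 (le_of_eq hxy))

/-! ### The hyperbolic disk and rescaled spaces -/

/-- The complex unit disk, to be equipped with the hyperbolic metric. -/
@[ext]
structure HypDisk where
  /-- The underlying point of the unit disk. -/
  toDisc : Complex.UnitDisc

namespace HypDisk

/-- The complex number underlying a point of the disk. -/
def toComplex (z : HypDisk) : ℂ := (z.toDisc : ℂ)

/-- The centre of the disk. -/
noncomputable instance : Zero HypDisk := ⟨⟨0⟩⟩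

lemma norm_lt_one (z : HypDisk) : ‖z.toComplex‖ < 1 := z.toDisc.norm_lt_one

lemma toComplex_injective : Function.Injective toComplex := fun _ _ h =>
  HypDisk.ext (Complex.UnitDisc.coe_injective h)

/-- The pseudo-hyperbolic distance `|z - w| / |1 - w̄ z|`. -/
noncomputable def pseudoDist (z w : HypDisk) : ℝ :=
  ‖(z.toComplex - w.toComplex) / (1 - (starRingEnd ℂ) w.toComplex * z.toComplex)‖

lemma one_sub_ne_zero {a b : ℂ} (ha : ‖a‖ < 1) (hb : ‖b‖ < 1) :
    1 - (starRingEnd ℂ) b * a ≠ 0 := by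
  intro h
  have h1 : (starRingEnd ℂ) b * a = 1 := (sub_eq_zero.1 h).symm
  have h2 : ‖b‖ * ‖a‖ = 1 := by simpa using congrArg norm h1
  nlinarith [norm_nonneg a, norm_nonneg b]

lemma normSq_identity (a b : ℂ) :
    ‖1 - (starRingEnd ℂ) b * a‖ ^ 2 - ‖a - b‖ ^ 2 = (1 - ‖a‖ ^ 2) * (1 - ‖b‖ ^ 2) := by
  simp only [← Complex.normSq_eq_norm_sq, Complex.normSq_apply, Complex.sub_re, Complex.sub_im,
    Complex.mul_re, Complex.mul_im, Complex.conj_re, Complex.conj_im, Complex.one_re,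
    Complex.one_im]
  ring

lemma norm_mobius_lt_one {a b : ℂ} (ha : ‖a‖ < 1) (hb : ‖b‖ < 1) :
    ‖(a - b) / (1 - (starRingEnd ℂ) b * a)‖ < 1 := by
  have h0 : 0 < ‖1 - (starRingEnd ℂ) b * a‖ := norm_pos_iff.2 (one_sub_ne_zero ha hb)
  rw [norm_div, div_lt_one h0]
  have h1 := normSq_identity a b
  have h2 : 0 < (1 - ‖a‖ ^ 2) * (1 - ‖b‖ ^ 2) :=
    mul_pos (by nlinarith [norm_nonneg a]) (by nlinarith [norm_nonneg b])
  exact lt_of_pow_lt_pow_left₀ 2 h0.le (by linarith)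

lemma pseudoDist_lt_one (z w : HypDisk) : pseudoDist z w < 1 :=
  norm_mobius_lt_one z.norm_lt_one w.norm_lt_one

lemma pseudoDist_nonneg (z w : HypDisk) : 0 ≤ pseudoDist z w := norm_nonneg _

lemma pseudoDist_comm (z w : HypDisk) : pseudoDist z w = pseudoDist w z := by
  unfold pseudoDist
  rw [norm_div, norm_div, norm_sub_rev, ← Complex.norm_conj (1 - _)]
  simp [mul_comm]

lemma norm_mobius_le {a b : ℂ} (ha : ‖a‖ < 1) (hb : ‖b‖ < 1) :
    ‖(a - b) / (1 - (starRingEnd ℂ) b * a)‖ ≤ (‖a‖ + ‖b‖) / (1 + ‖a‖ * ‖b‖) := by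
  have h0 : 0 < ‖1 - (starRingEnd ℂ) b * a‖ := norm_pos_iff.2 (one_sub_ne_zero ha hb)
  have h3 : ‖1 - (starRingEnd ℂ) b * a‖ ≤ 1 + ‖a‖ * ‖b‖ := by
    refine (norm_sub_le _ _).trans ?_
    simp [mul_comm]
  have hp : 0 < 1 + ‖a‖ * ‖b‖ := by positivity
  rw [norm_div, div_le_div_iff₀ h0 hp]
  refine (sq_le_sq₀ (by positivity) (by positivity)).1 ?_
  have h1 := normSq_identity a b
  have h2 : 0 ≤ (1 - ‖a‖ ^ 2) * (1 - ‖b‖ ^ 2) :=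
    mul_nonneg (by nlinarith [norm_nonneg a]) (by nlinarith [norm_nonneg b])
  have h4 : ‖1 - (starRingEnd ℂ) b * a‖ ^ 2 ≤ (1 + ‖a‖ * ‖b‖) ^ 2 := by gcongr
  have h5 : ‖a - b‖ ^ 2 = ‖1 - (starRingEnd ℂ) b * a‖ ^ 2 - (1 - ‖a‖ ^ 2) * (1 - ‖b‖ ^ 2) := by
    linarith
  rw [mul_pow, mul_pow, h5]
  nlinarith [mul_le_mul_of_nonneg_left h4 h2]

lemma mobius_invariance {a b c : ℂ} (ha : ‖a‖ < 1) (hb : ‖b‖ < 1) (hc : ‖c‖ < 1) :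
    ‖((a - b) / (1 - (starRingEnd ℂ) b * a) - (c - b) / (1 - (starRingEnd ℂ) b * c)) /
      (1 - (starRingEnd ℂ) ((c - b) / (1 - (starRingEnd ℂ) b * c)) *
        ((a - b) / (1 - (starRingEnd ℂ) b * a)))‖ =
    ‖(a - c) / (1 - (starRingEnd ℂ) c * a)‖ := by
  have hab := one_sub_ne_zero ha hb
  have hcb := one_sub_ne_zero hc hb
  have hbc := one_sub_ne_zero hb hc
  have hbb := one_sub_ne_zero hb hb
  have hac := one_sub_ne_zero ha hc
  have e1 : (a - b) / (1 - (starRingEnd ℂ) b * a) - (c - b) / (1 - (starRingEnd ℂ) b * c) =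
      (a - c) * (1 - (starRingEnd ℂ) b * b) /
        ((1 - (starRingEnd ℂ) b * a) * (1 - (starRingEnd ℂ) b * c)) := by
    rw [div_sub_div _ _ hab hcb]; congr 1; ring
  have e2 : 1 - (starRingEnd ℂ) ((c - b) / (1 - (starRingEnd ℂ) b * c)) *
        ((a - b) / (1 - (starRingEnd ℂ) b * a)) =
      (1 - (starRingEnd ℂ) c * a) * (1 - (starRingEnd ℂ) b * b) /
        ((1 - (starRingEnd ℂ) c * b) * (1 - (starRingEnd ℂ) b * a)) := by
    have e3 : (starRingEnd ℂ) (1 - (starRingEnd ℂ) b * c) = 1 - (starRingEnd ℂ) c * b := by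
      simp [mul_comm]
    rw [map_div₀, e3, map_sub, div_mul_div_comm, eq_div_iff (mul_ne_zero hbc hab), sub_mul,
      div_mul_cancel₀ _ (mul_ne_zero hbc hab)]
    ring
  have e4 : ‖1 - (starRingEnd ℂ) c * b‖ = ‖1 - (starRingEnd ℂ) b * c‖ := by
    rw [← Complex.norm_conj]; simp [mul_comm]
  have n1 := norm_ne_zero_iff.2 hab
  have n2 := norm_ne_zero_iff.2 hcb
  have n3 := norm_ne_zero_iff.2 hbb
  have n4 := norm_ne_zero_iff.2 hac
  rw [e1, e2]
  simp only [norm_div, norm_mul, e4]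
  rw [div_div_div_eq, div_eq_div_iff (by positivity) n4]
  ring

lemma artanh_norm_mobius_le {a b : ℂ} (ha : ‖a‖ < 1) (hb : ‖b‖ < 1) :
    Real.artanh ‖(a - b) / (1 - (starRingEnd ℂ) b * a)‖ ≤ Real.artanh ‖a‖ + Real.artanh ‖b‖ := by
  have hs : (‖a‖ + ‖b‖) / (1 + ‖a‖ * ‖b‖) < 1 := by
    rw [div_lt_one (by positivity)]
    nlinarith
  have h1 := Real.artanh_le_artanh (lt_of_lt_of_le (by norm_num) (norm_nonneg _)) hs
    (norm_mobius_le ha hb)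
  refine h1.trans (le_of_eq ?_)
  have hma : ‖a‖ ∈ Icc (-1 : ℝ) 1 := ⟨by linarith [norm_nonneg a], ha.le⟩
  have hmb : ‖b‖ ∈ Icc (-1 : ℝ) 1 := ⟨by linarith [norm_nonneg b], hb.le⟩
  have hms : (‖a‖ + ‖b‖) / (1 + ‖a‖ * ‖b‖) ∈ Icc (-1 : ℝ) 1 :=
    ⟨le_trans (by norm_num) (by positivity : (0 : ℝ) ≤ _), hs.le⟩
  have pa : 0 < 1 - ‖a‖ := by linarith
  have pb : 0 < 1 - ‖b‖ := by linarith
  have qa := norm_nonneg a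
  have qb := norm_nonneg b
  rw [Real.artanh_eq_half_log hma, Real.artanh_eq_half_log hmb, Real.artanh_eq_half_log hms,
    ← mul_add, ← Real.log_mul (by positivity) (by positivity)]
  congr 2
  have e1 : 1 - (‖a‖ + ‖b‖) / (1 + ‖a‖ * ‖b‖) = (1 - ‖a‖) * (1 - ‖b‖) / (1 + ‖a‖ * ‖b‖) := by
    field_simp; ring
  have e2 : 1 + (‖a‖ + ‖b‖) / (1 + ‖a‖ * ‖b‖) = (1 + ‖a‖) * (1 + ‖b‖) / (1 + ‖a‖ * ‖b‖) := by
    field_simp; ring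
  rw [e1, e2]
  field_simp

/-- The hyperbolic metric with line element `|dz| / (1 - |z|²)`, that is, the distance
`artanh (|z - w| / |1 - w̄ z|)`. In this normalization `d(0, tanh R) = R`, and the circle of
radius `R` has length `(π / 2) (e^{2R} - e^{-2R})`. -/
noncomputable instance : MetricSpace HypDisk where
  dist z w := Real.artanh (pseudoDist z w)
  dist_self z := by simp [pseudoDist]
  dist_comm z w := by rw [pseudoDist_comm]
  dist_triangle x y z := by
    have h := artanh_norm_mobius_le (norm_mobius_lt_one x.norm_lt_one y.norm_lt_one)
      (norm_mobius_lt_one z.norm_lt_one y.norm_lt_one)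
    rw [mobius_invariance x.norm_lt_one y.norm_lt_one z.norm_lt_one] at h
    rw [pseudoDist_comm y z]
    exact h
  eq_of_dist_eq_zero := by
    intro z w h
    have h1 : pseudoDist z w = 0 := by
      rcases Real.artanh_eq_zero_iff.1 h with h | h | h
      · linarith [pseudoDist_nonneg z w]
      · exact h
      · linarith [pseudoDist_lt_one z w]
    rw [pseudoDist, norm_eq_zero, div_eq_zero_iff] at h1
    rcases h1 with h1 | h1
    · exact toComplex_injective (sub_eq_zero.1 h1)
    · exact absurd h1 (one_sub_ne_zero z.norm_lt_one w.norm_lt_one)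

end HypDisk

/-- The set `X`, to be equipped with its metric scaled by the factor `c > 0`. -/
@[ext, nolint unusedArguments]
structure Rescaled {c : ℝ} (_hc : 0 < c) (X : Type*) where
  /-- The underlying point of `X`. -/
  point : X

noncomputable instance {c : ℝ} (hc : 0 < c) {X : Type*} [MetricSpace X] :
    MetricSpace (Rescaled hc X) where
  dist x y := c * dist x.point y.point
  dist_self x := by rw [dist_self, mul_zero]
  dist_comm x y := by rw [dist_comm]
  dist_triangle x y z := by
    rw [← mul_add]
    exact mul_le_mul_of_nonneg_left (dist_triangle _ _ _) hc.le
  eq_of_dist_eq_zero := by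
    intro x y h
    exact Rescaled.ext (eq_of_dist_eq_zero ((mul_eq_zero.1 h).resolve_left hc.ne'))

/-! ### Rough similarities -/

/-- `Φ : Y → X` is an `(L, C)`-rough similarity. -/
structure IsRoughSimilarity {Y X : Type*} [MetricSpace Y] [MetricSpace X] (L C : ℝ) (Φ : Y → X) :
    Prop where
  pos : 0 < L
  nonneg : 0 ≤ C
  lower : ∀ x y : Y, L * dist x y - C ≤ dist (Φ x) (Φ y)
  upper : ∀ x y : Y, dist (Φ x) (Φ y) ≤ L * dist x y + C
  hausdorff : Metric.hausdorffEDist (range Φ) univ ≤ ENNReal.ofReal C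

/-! Everything comes from comparing three metrics on the disk: the hyperbolic one, the Euclidean
one, and `d_ε`, whose line element is `e^{-ε d(z,0)} |dz| / (1 - |z|²)`.

Hyperbolicity. By `sinh_dist`, `sinh d(z,w)` is `|z - w|` divided by one factor for each point, so
Ptolemy's inequality in the plane carries over to `sinh d`. Its logarithm is the four-point
condition up to an additive constant (`four_point`), and this makes triangles thin.

Uniformity for `ε = 2`. Since `e^{-2 d(z,0)} = (1 - |z|) / (1 + |z|)`, the line element is `|dz| /
(1 + |z|)²`, which lies between `|dz| / 4` and `|dz|`. Hence `Y_2` is bi-Lipschitz to the Euclidean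
disk, and segments bent towards the centre are uniform curves.

Failure for `ε > 2`. Circles of radius `T` have `d_ε`-length of order `e^{(2-ε)T}`, which tends to
`0`: the boundary collapses to a point. Antipodal points at radius `R` are therefore at
`d_ε`-distance at most a constant times `e^{-εR}`, by a detour far out
(`uniformizedDist_antipodal_le`). A uniform curve between them may not use this detour:
`IsUniformCurve.density_le` keeps the density at least `e^{-εR} / (1 + λ)` along it. There
`d_ε`-length controls hyperbolic length (`edist_point_le_mul_eVariationOn`), so the hyperbolic
distance `2R` of the end points would be bounded independently of `R`.

Rescaling. Multiplying the metric by `c = ε₁ / ε` turns the density with parameter `ε` into the old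
density with parameter `ε₁` and multiplies arc length by `c`, so `Z_ε` is `Y_{ε₁}` scaled by `c`,
and uniformity is invariant under scaling. The values `ε = 3`, `ε₁ = 2` refute the general
assertion. -/

open scoped Pointwise

/-! ### Thin triangles from the four-point condition -/

/-- If `p` nearly lies between `y` and `z`, then the four-point condition puts it near every
geodesic segment from `y` to `z`. -/
lemma exists_mem_segment_dist_le {X : Type*} [MetricSpace X] {C : ℝ} (hC : 0 ≤ C)
    (h4 : ∀ x y z w : X,
      dist x y + dist z w ≤ max (dist x z + dist y w) (dist x w + dist y z) + C)
    {S : Set X} {y z p : X} (hS : IsGeodesicSegment S y z)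
    (hp : dist p y + dist p z ≤ dist y z + C) : ∃ q ∈ S, dist p q ≤ 2 * C := by
  obtain ⟨γ, ⟨h0, h1, hγ⟩, rfl⟩ := hS
  have m0 : (0 : ℝ) ∈ Icc 0 (dist y z) := ⟨le_rfl, dist_nonneg⟩
  have m1 : dist y z ∈ Icc 0 (dist y z) := ⟨dist_nonneg, le_rfl⟩
  rcases le_total (dist p y) (dist y z) with h | h
  · have mp : dist p y ∈ Icc 0 (dist y z) := ⟨dist_nonneg, h⟩
    refine ⟨γ (dist p y), mem_image_of_mem γ mp, ?_⟩
    have e0 := hγ _ mp _ m0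
    have e1 := hγ _ mp _ m1
    rw [h0, sub_zero, abs_of_nonneg dist_nonneg] at e0
    rw [h1, abs_sub_comm, abs_of_nonneg (sub_nonneg.2 h)] at e1
    have := h4 p (γ (dist p y)) y z
    rw [e0, e1] at this
    rcases max_cases (dist p y + (dist y z - dist p y)) (dist p z + dist p y) with h' | h' <;>
      linarith
  -- If `p` is farther from `y` than `z` is, then `hp` leaves at most `C` for `d(p,z)`.
  · refine ⟨z, ⟨_, m1, h1⟩, ?_⟩
    linarith

lemma segment_subset_of_four_point {X : Type*} [MetricSpace X] {C : ℝ} (hC : 0 ≤ C)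
    (h4 : ∀ x y z w : X,
      dist x y + dist z w ≤ max (dist x z + dist y w) (dist x w + dist y z) + C)
    {x y z : X} {Sxy Syz Szx : Set X} (hxy : IsGeodesicSegment Sxy x y)
    (hyz : IsGeodesicSegment Syz y z) (hzx : IsGeodesicSegment Szx z x) :
    Sxy ⊆ ⋃ w ∈ Syz ∪ Szx, Metric.closedBall w (2 * C) := by
  obtain ⟨γ, ⟨h0, h1, hγ⟩, rfl⟩ := hxy
  rintro _ ⟨t, ht, rfl⟩
  have e0 := hγ _ ht _ ⟨le_rfl, dist_nonneg⟩
  have e1 := hγ _ ht _ ⟨dist_nonneg, le_rfl⟩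
  rw [h0, sub_zero, abs_of_nonneg ht.1] at e0
  rw [h1, abs_sub_comm, abs_of_nonneg (sub_nonneg.2 ht.2)] at e1
  -- Whichever sum attains the maximum, this says that `γ t` lies between `z` and one of `y`, `x` up
  -- to the error `C`.
  have key := h4 (γ t) z x y
  rw [e0, e1, dist_comm z x] at key
  simp only [mem_iUnion, Metric.mem_closedBall, exists_prop]
  rcases max_cases (t + dist z y) (dist x y - t + dist x z) with h' | h'
  · obtain ⟨q, hq, hd⟩ := exists_mem_segment_dist_le (p := γ t) hC h4 hyz (by
      rw [e1, dist_comm y z]; linarith)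
    exact ⟨q, Or.inl hq, hd⟩
  · obtain ⟨q, hq, hd⟩ := exists_mem_segment_dist_le (p := γ t) hC h4 hzx (by
      rw [e0, dist_comm z x]; linarith)
    exact ⟨q, Or.inr hq, hd⟩

/-! ### The hyperbolic disk -/

namespace HypDisk

lemma dist_def (z w : HypDisk) : dist z w = Real.artanh (pseudoDist z w) := rfl

lemma pseudoDist_mem (z w : HypDisk) : pseudoDist z w ∈ Ioo (-1 : ℝ) 1 :=
  ⟨by linarith [pseudoDist_nonneg z w], pseudoDist_lt_one z w⟩

lemma one_sub_sq_pos (z : HypDisk) : 0 < 1 - ‖z.toComplex‖ ^ 2 := by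
  nlinarith [z.norm_lt_one, norm_nonneg z.toComplex]

lemma toComplex_zero : (0 : HypDisk).toComplex = 0 := rfl

/-- `sinh (artanh r) = r / √(1 - r²)`, and `normSq_identity` factors `1 - r²`. The denominator
splits into one factor for each point, which is what lets Euclidean inequalities pass to the disk.
-/
lemma sinh_dist (z w : HypDisk) : Real.sinh (dist z w) =
    ‖z.toComplex - w.toComplex‖ /
      √((1 - ‖z.toComplex‖ ^ 2) * (1 - ‖w.toComplex‖ ^ 2)) := by
  have hm : 0 < ‖1 - (starRingEnd ℂ) w.toComplex * z.toComplex‖ :=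
    norm_pos_iff.2 (one_sub_ne_zero z.norm_lt_one w.norm_lt_one)
  have h := normSq_identity z.toComplex w.toComplex
  rw [dist_def, Real.sinh_artanh (pseudoDist_mem z w)]
  have e : 1 - pseudoDist z w ^ 2 = (1 - ‖z.toComplex‖ ^ 2) * (1 - ‖w.toComplex‖ ^ 2) /
      ‖1 - (starRingEnd ℂ) w.toComplex * z.toComplex‖ ^ 2 := by
    rw [pseudoDist, norm_div, ← h, div_pow, sub_div, div_self (by positivity)]
  rw [e, Real.sqrt_div' _ (by positivity), Real.sqrt_sq hm.le, pseudoDist, norm_div,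
    div_div_div_cancel_right₀ hm.ne']

/-- In Ptolemy's inequality each of the three products contains every point exactly once, so after
division by the factors of `sinh_dist` all terms have the same denominator. -/
lemma sinh_dist_ptolemy (x y z w : HypDisk) :
    Real.sinh (dist x y) * Real.sinh (dist z w) ≤
      Real.sinh (dist x z) * Real.sinh (dist y w) +
        Real.sinh (dist x w) * Real.sinh (dist y z) := by
  have hx := x.one_sub_sq_pos
  have hy := y.one_sub_sq_pos
  have hz := z.one_sub_sq_pos
  have hw := w.one_sub_sq_pos
  have key := EuclideanGeometry.mul_dist_le_mul_dist_add_mul_dist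
    x.toComplex z.toComplex y.toComplex w.toComplex
  simp only [dist_eq_norm] at key
  rw [norm_sub_rev z.toComplex y.toComplex] at key
  simp only [sinh_dist, Real.sqrt_mul hx.le, Real.sqrt_mul hy.le, Real.sqrt_mul hz.le]
  have sx := Real.sqrt_pos.2 hx
  have sy := Real.sqrt_pos.2 hy
  have sz := Real.sqrt_pos.2 hz
  have sw := Real.sqrt_pos.2 hw
  set a := √(1 - ‖x.toComplex‖ ^ 2)
  set b := √(1 - ‖y.toComplex‖ ^ 2)
  set c := √(1 - ‖z.toComplex‖ ^ 2)
  set d := √(1 - ‖w.toComplex‖ ^ 2)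
  simp only [div_mul_div_comm]
  rw [show a * c * (b * d) = a * b * (c * d) by ring,
    show a * d * (b * c) = a * b * (c * d) by ring, ← add_div]
  gcongr
  linarith

lemma exp_le_four_mul_sinh {t : ℝ} (ht : 1 ≤ t) : Real.exp t ≤ 4 * Real.sinh t := by
  have h1 : 2 ≤ Real.exp t := by linarith [Real.add_one_le_exp t]
  have h2 : Real.exp (-t) ≤ 1 := Real.exp_le_one_iff.2 (by linarith)
  rw [Real.sinh_eq]
  linarith

lemma sinh_le_exp_div_two (t : ℝ) : Real.sinh t ≤ Real.exp t / 2 := by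
  rw [Real.sinh_eq]
  linarith [Real.exp_pos (-t)]

/-- For distances at least `1`, `sinh t` is `e^t` up to constants, and Ptolemy's inequality gives
`e^{d(x,y)+d(z,w)} ≤ 16 · 2 · e^M / 4 = 8 e^M ≤ e^{M+3}`. If one distance on the left is at most
`1`, the triangle inequality suffices, with error `2`. -/
lemma four_point (x y z w : HypDisk) :
    dist x y + dist z w ≤ max (dist x z + dist y w) (dist x w + dist y z) + 3 := by
  rcases le_total (dist x y) 1 with h | h
  · have h1 := dist_triangle4 z x y w
    rw [dist_comm z x] at h1
    linarith [le_max_left (dist x z + dist y w) (dist x w + dist y z)]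
  rcases le_total (dist z w) 1 with h' | h'
  · have h1 := dist_triangle4 x z w y
    rw [dist_comm w y] at h1
    linarith [le_max_left (dist x z + dist y w) (dist x w + dist y z)]
  set M := max (dist x z + dist y w) (dist x w + dist y z) with hM
  have b1 : Real.sinh (dist x z) * Real.sinh (dist y w) ≤ Real.exp M / 4 := by
    calc _ ≤ Real.exp (dist x z) / 2 * (Real.exp (dist y w) / 2) :=
          mul_le_mul (sinh_le_exp_div_two _) (sinh_le_exp_div_two _)
            (Real.sinh_nonneg_iff.2 dist_nonneg) (by positivity)
      _ = Real.exp (dist x z + dist y w) / 4 := by rw [Real.exp_add]; ring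
      _ ≤ _ := by gcongr; exact le_max_left _ _
  have b2 : Real.sinh (dist x w) * Real.sinh (dist y z) ≤ Real.exp M / 4 := by
    calc _ ≤ Real.exp (dist x w) / 2 * (Real.exp (dist y z) / 2) :=
          mul_le_mul (sinh_le_exp_div_two _) (sinh_le_exp_div_two _)
            (Real.sinh_nonneg_iff.2 dist_nonneg) (by positivity)
      _ = Real.exp (dist x w + dist y z) / 4 := by rw [Real.exp_add]; ring
      _ ≤ _ := by gcongr; exact le_max_right _ _
  have b3 : Real.exp (dist x y + dist z w) ≤
      16 * (Real.sinh (dist x y) * Real.sinh (dist z w)) := by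
    calc _ = Real.exp (dist x y) * Real.exp (dist z w) := Real.exp_add _ _
      _ ≤ (4 * Real.sinh (dist x y)) * (4 * Real.sinh (dist z w)) :=
          mul_le_mul (exp_le_four_mul_sinh h) (exp_le_four_mul_sinh h') (Real.exp_pos _).le
            (by have := Real.sinh_nonneg_iff.2 (dist_nonneg (x := x) (y := y)); positivity)
      _ = _ := by ring
  have b4 := sinh_dist_ptolemy x y z w
  have b5 : (8 : ℝ) ≤ Real.exp 3 := by
    have := Real.add_one_le_exp (1 : ℝ)
    calc (8 : ℝ) = 2 ^ 3 := by norm_num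
      _ ≤ Real.exp 1 ^ 3 := by gcongr; linarith
      _ = Real.exp 3 := by rw [← Real.exp_nat_mul]; norm_num
  rw [← Real.exp_le_exp, Real.exp_add M]
  nlinarith [Real.exp_pos M]

/-! #### Comparison with the Euclidean metric -/

lemma dist_le_norm_div (z w : HypDisk) : dist z w ≤ ‖z.toComplex - w.toComplex‖ /
    √((1 - ‖z.toComplex‖ ^ 2) * (1 - ‖w.toComplex‖ ^ 2)) := by
  rw [← sinh_dist]
  exact Real.self_le_sinh_iff.2 dist_nonneg

/-- `r ≤ artanh r`, as the first term of a series with nonnegative terms. When `w` tends to `z` the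
factor tends to `1 - |z|²`, so together with `dist_le_norm_div` this recovers the line element. -/
lemma norm_sub_le_mul_dist (z w : HypDisk) : ‖z.toComplex - w.toComplex‖ ≤
    ‖1 - (starRingEnd ℂ) w.toComplex * z.toComplex‖ * dist z w := by
  have hm : 0 < ‖1 - (starRingEnd ℂ) w.toComplex * z.toComplex‖ :=
    norm_pos_iff.2 (one_sub_ne_zero z.norm_lt_one w.norm_lt_one)
  have h : pseudoDist z w ≤ dist z w := by
    have h0 := pseudoDist_nonneg z w
    have h1 := pseudoDist_lt_one z w
    have hs := le_hasSum (Real.hasSum_log_sub_log_of_abs_lt_one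
      (abs_lt.2 ⟨by linarith, h1⟩)) 0 fun k _ => by positivity
    rw [← Real.log_div (by linarith) (by linarith)] at hs
    rw [dist_def, Real.artanh_eq_half_log ⟨by linarith, h1.le⟩]
    norm_num at hs
    linarith
  rw [pseudoDist, norm_div, div_le_iff₀ hm] at h
  linarith

lemma norm_one_sub_le_two (z w : HypDisk) :
    ‖1 - (starRingEnd ℂ) w.toComplex * z.toComplex‖ ≤ 2 := by
  refine (norm_sub_le _ _).trans ?_
  rw [norm_mul, Complex.norm_conj, norm_one]
  nlinarith [z.norm_lt_one, w.norm_lt_one, norm_nonneg z.toComplex, norm_nonneg w.toComplex]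

lemma norm_sub_le_two_mul_dist (z w : HypDisk) :
    ‖z.toComplex - w.toComplex‖ ≤ 2 * dist z w :=
  (norm_sub_le_mul_dist z w).trans
    (mul_le_mul_of_nonneg_right (norm_one_sub_le_two z w) dist_nonneg)

lemma continuous_toComplex : Continuous toComplex :=
  (LipschitzWith.of_dist_le_mul (K := 2) fun z w => by
    simpa [dist_eq_norm] using norm_sub_le_two_mul_dist z w).continuous

lemma isInducing_toComplex : IsInducing toComplex := by
  refine isInducing_iff_nhds.2 fun z => le_antisymm ?_ ?_
  · exact Filter.map_le_iff_le_comap.1 continuous_toComplex.continuousAt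
  · rw [(Metric.nhds_basis_ball (x := z)).ge_iff]
    intro r hr
    have hz := z.one_sub_sq_pos
    have hc : ContinuousAt (fun a : ℂ => ‖a - z.toComplex‖ /
        √((1 - ‖a‖ ^ 2) * (1 - ‖z.toComplex‖ ^ 2))) z.toComplex := by
      refine ContinuousAt.div (by fun_prop) (by fun_prop) ?_
      have : 0 < (1 - ‖z.toComplex‖ ^ 2) * (1 - ‖z.toComplex‖ ^ 2) := by positivity
      exact (Real.sqrt_pos.2 this).ne'
    have hlt := hc.tendsto.eventually_lt_const (u := r) (by simpa using hr)
    exact Filter.mem_comap.2 ⟨_, hlt, fun w hw => (dist_le_norm_div w z).trans_lt hw⟩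

/-- The point of the disk with a given complex coordinate; the centre for coordinates outside
of the disk. -/
noncomputable def ofComplex (z : ℂ) : HypDisk :=
  if h : ‖z‖ < 1 then ⟨Complex.UnitDisc.mk z h⟩ else 0

lemma toComplex_ofComplex {z : ℂ} (h : ‖z‖ < 1) : (ofComplex z).toComplex = z := by
  rw [ofComplex, dif_pos h]
  rfl

lemma ofComplex_toComplex (z : HypDisk) : ofComplex z.toComplex = z :=
  toComplex_injective (toComplex_ofComplex z.norm_lt_one)

lemma dist_zero_right (z : HypDisk) : dist z 0 = Real.artanh ‖z.toComplex‖ := by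
  rw [dist_def, pseudoDist, toComplex_zero]
  simp

lemma exp_neg_two_mul_dist (z : HypDisk) :
    Real.exp (-2 * dist z 0) = (1 - ‖z.toComplex‖) / (1 + ‖z.toComplex‖) := by
  have h := z.norm_lt_one
  have h0 := norm_nonneg z.toComplex
  rw [dist_zero_right, Real.artanh_eq_half_log ⟨by linarith, h.le⟩,
    show -2 * (1 / 2 * Real.log ((1 + ‖z.toComplex‖) / (1 - ‖z.toComplex‖))) =
      -Real.log ((1 + ‖z.toComplex‖) / (1 - ‖z.toComplex‖)) by ring, Real.exp_neg,
    Real.exp_log (by apply div_pos <;> linarith), inv_div]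

/-! #### Geodesics -/

/-- The isometry of the disk that moves `b` to the centre. -/
noncomputable def mobius (b z : HypDisk) : HypDisk :=
  ofComplex ((z.toComplex - b.toComplex) / (1 - (starRingEnd ℂ) b.toComplex * z.toComplex))

lemma toComplex_mobius (b z : HypDisk) : (mobius b z).toComplex =
    (z.toComplex - b.toComplex) / (1 - (starRingEnd ℂ) b.toComplex * z.toComplex) :=
  toComplex_ofComplex (norm_mobius_lt_one z.norm_lt_one b.norm_lt_one)

lemma dist_mobius (b z w : HypDisk) : dist (mobius b z) (mobius b w) = dist z w := by
  rw [dist_def, dist_def, pseudoDist, toComplex_mobius, toComplex_mobius,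
    mobius_invariance z.norm_lt_one b.norm_lt_one w.norm_lt_one, ← pseudoDist]

lemma mobius_neg_mobius (b z : HypDisk) :
    mobius (ofComplex (-b.toComplex)) (mobius b z) = z := by
  have hb : (ofComplex (-b.toComplex)).toComplex = -b.toComplex :=
    toComplex_ofComplex (by simpa using b.norm_lt_one)
  apply toComplex_injective
  rw [toComplex_mobius, toComplex_mobius, hb]
  have h1 := one_sub_ne_zero z.norm_lt_one b.norm_lt_one
  have h2 := one_sub_ne_zero b.norm_lt_one b.norm_lt_one
  rw [map_neg]
  set a := z.toComplex
  set c := b.toComplex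
  set k := (starRingEnd ℂ) c
  have e1 : (a - c) / (1 - k * a) - -c = a * (1 - k * c) / (1 - k * a) := by
    rw [sub_neg_eq_add, div_add' _ _ _ h1]; ring
  have e2 : 1 - -k * ((a - c) / (1 - k * a)) = (1 - k * c) / (1 - k * a) := by
    rw [neg_mul, sub_neg_eq_add, mul_div_assoc', add_div' _ _ _ h1]; ring
  rw [e1, e2, div_div_div_cancel_right₀ h1, mul_div_cancel_right₀ _ h2]

/-- The point at hyperbolic distance `t` from the centre in the direction `u`. -/
noncomputable def polar (u : ℂ) (t : ℝ) : HypDisk := ofComplex (Real.tanh t * u)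

lemma toComplex_polar {u : ℂ} (hu : ‖u‖ = 1) (t : ℝ) :
    (polar u t).toComplex = Real.tanh t * u :=
  toComplex_ofComplex (by
    rw [norm_mul, hu, mul_one, Complex.norm_real, Real.norm_eq_abs]
    exact Real.abs_tanh_lt_one t)

lemma tanh_le_tanh {s t : ℝ} (h : s ≤ t) : Real.tanh s ≤ Real.tanh t := by
  rwa [← Real.artanh_le_artanh_iff ⟨Real.neg_one_lt_tanh s, Real.tanh_lt_one s⟩
    ⟨Real.neg_one_lt_tanh t, Real.tanh_lt_one t⟩, Real.artanh_tanh, Real.artanh_tanh]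

lemma artanh_abs_tanh (t : ℝ) : Real.artanh |Real.tanh t| = |t| := by
  rcases le_total 0 t with h | h
  · rw [abs_of_nonneg h, abs_of_nonneg (by simpa using tanh_le_tanh h), Real.artanh_tanh]
  · rw [abs_of_nonpos h, abs_of_nonpos (by simpa using tanh_le_tanh h), ← Real.tanh_neg,
      Real.artanh_tanh]

lemma tanh_sub' (s t : ℝ) : (Real.tanh s - Real.tanh t) / (1 - Real.tanh t * Real.tanh s) =
    Real.tanh (s - t) := by
  have hs := Real.cosh_pos s
  have ht := Real.cosh_pos t
  have hst : 0 < Real.cosh s * Real.cosh t - Real.sinh s * Real.sinh t := by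
    rw [← Real.cosh_sub]; exact Real.cosh_pos _
  rw [Real.tanh_eq_sinh_div_cosh (s - t), Real.sinh_sub, Real.cosh_sub,
    Real.tanh_eq_sinh_div_cosh, Real.tanh_eq_sinh_div_cosh]
  have e : 1 - Real.sinh t / Real.cosh t * (Real.sinh s / Real.cosh s) =
      (Real.cosh s * Real.cosh t - Real.sinh s * Real.sinh t) / (Real.cosh s * Real.cosh t) := by
    field_simp
  rw [e]
  field_simp

/-- Parameters of both signs are allowed, so whole diameters are isometric copies of the line; this
also gives the distance of antipodal points. -/
lemma dist_polar {u : ℂ} (hu : ‖u‖ = 1) (s t : ℝ) : dist (polar u s) (polar u t) = |s - t| := by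
  have huu : (starRingEnd ℂ) u * u = 1 := by
    rw [← Complex.normSq_eq_conj_mul_self, Complex.normSq_eq_norm_sq, hu]; simp
  have e : (1 : ℂ) - (starRingEnd ℂ) (Real.tanh t * u) * (Real.tanh s * u) =
      ((1 - Real.tanh t * Real.tanh s : ℝ) : ℂ) := by
    rw [map_mul, Complex.conj_ofReal]
    simp only [Complex.ofReal_sub, Complex.ofReal_one, Complex.ofReal_mul]
    linear_combination (-(Real.tanh t : ℂ) * Real.tanh s) * huu
  rw [dist_def, pseudoDist, toComplex_polar hu, toComplex_polar hu, e, ← sub_mul, norm_div,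
    norm_mul, hu, mul_one, ← Complex.ofReal_sub, Complex.norm_real, Complex.norm_real, ← norm_div,
    tanh_sub', Real.norm_eq_abs, artanh_abs_tanh]

lemma polar_zero (u : ℂ) : polar u 0 = 0 := by
  rw [polar, Real.tanh_zero, Complex.ofReal_zero, zero_mul, ← toComplex_zero, ofComplex_toComplex]

lemma dist_polar_zero {u : ℂ} (hu : ‖u‖ = 1) {t : ℝ} (ht : 0 ≤ t) : dist (polar u t) 0 = t := by
  rw [← polar_zero u, dist_polar hu, sub_zero, abs_of_nonneg ht]

lemma exists_polar (z : HypDisk) : ∃ u : ℂ, ‖u‖ = 1 ∧ polar u (dist z 0) = z := by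
  have ht : Real.tanh (dist z 0) = ‖z.toComplex‖ := by
    rw [dist_zero_right, Real.tanh_artanh ⟨by linarith [norm_nonneg z.toComplex], z.norm_lt_one⟩]
  rcases eq_or_ne z.toComplex 0 with h | h
  · refine ⟨1, norm_one, toComplex_injective ?_⟩
    rw [toComplex_polar norm_one, ht, h]
    simp
  · refine ⟨z.toComplex / ‖z.toComplex‖, ?_, toComplex_injective ?_⟩
    · simp [h]
    · rw [toComplex_polar (by simp [h]), ht]
      have : (‖z.toComplex‖ : ℂ) ≠ 0 := by simpa using h
      field_simp

/-- A Möbius isometry moves `x` to the centre, where radii are geodesics, and its inverse carries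
the radius back. -/
lemma exists_isGeodesicPath (x y : HypDisk) : ∃ γ : ℝ → HypDisk, IsGeodesicPath γ x y := by
  have hx : mobius x x = 0 := toComplex_injective (by
    rw [toComplex_mobius, sub_self, zero_div, toComplex_zero])
  obtain ⟨u, hu, hy⟩ := exists_polar (mobius x y)
  have hd : dist (mobius x y) 0 = dist x y := by
    rw [← hx, dist_mobius, dist_comm]
  refine ⟨fun t => mobius (ofComplex (-x.toComplex)) (polar u t), ?_, ?_, fun s _ t _ => ?_⟩
  · simp only [polar_zero]
    rw [← hx, mobius_neg_mobius]
  · simp only [← hd]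
    rw [hy, mobius_neg_mobius]
  · rw [dist_mobius, dist_polar hu]

/-! #### Gromov hyperbolicity -/

lemma isCompact_closedBall_zero (R : ℝ) : IsCompact (Metric.closedBall (0 : HypDisk) R) := by
  rw [isInducing_toComplex.isCompact_iff]
  have : toComplex '' Metric.closedBall 0 R = Metric.closedBall 0 (Real.tanh R) := by
    ext z
    constructor
    · rintro ⟨w, hw, rfl⟩
      rw [mem_closedBall_zero_iff, ← Real.tanh_artanh (x := ‖w.toComplex‖)
        ⟨by linarith [norm_nonneg w.toComplex], w.norm_lt_one⟩, ← dist_zero_right]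
      exact tanh_le_tanh hw
    · intro hz
      rw [mem_closedBall_zero_iff] at hz
      have h1 := hz.trans_lt (Real.tanh_lt_one R)
      refine ⟨ofComplex z, ?_, toComplex_ofComplex h1⟩
      rw [Metric.mem_closedBall, dist_zero_right, toComplex_ofComplex h1, ← Real.artanh_tanh R]
      exact Real.artanh_le_artanh (by linarith [norm_nonneg z]) (Real.tanh_lt_one R) hz
  rw [this]
  exact isCompact_closedBall _ _

instance : ProperSpace HypDisk := by
  refine ⟨fun x r => ?_⟩
  exact (isCompact_closedBall_zero (r + dist x 0)).of_isClosed_subset Metric.isClosed_closedBall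
    (Metric.closedBall_subset_closedBall' le_rfl)

theorem isGromovHyperbolic : IsGromovHyperbolic HypDisk where
  complete := inferInstance
  unbounded h := by
    obtain ⟨R, hR⟩ := h.subset_closedBall 0
    have h1 := hR (mem_univ (polar 1 (|R| + 1)))
    rw [Metric.mem_closedBall, dist_polar_zero norm_one (by positivity)] at h1
    linarith [le_abs_self R]
  locallyCompact := inferInstance
  geodesic := exists_isGeodesicPath
  thin := ⟨2 * 3, by norm_num, fun _ _ _ _ _ _ h1 h2 h3 =>
    segment_subset_of_four_point (by norm_num) four_point h1 h2 h3⟩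

end HypDisk

/-! ### From local to global distance bounds -/

/-- A mean value inequality: the right slopes of `t ↦ d(f a, f t)` are bounded by the local speed of
`f`. It is used with values in `Y_ε` for upper bounds on `d_ε`, and with values in `ℂ` for lower
bounds. -/
lemma dist_le_sub_of_local_bound {M : Type*} [PseudoMetricSpace M] {f : ℝ → M} {a b : ℝ}
    (hab : a ≤ b) (hf : ContinuousOn f (Icc a b)) {B B' : ℝ → ℝ} (hB : ContinuousOn B (Icc a b))
    (hB' : ∀ t ∈ Ico a b, HasDerivWithinAt B (B' t) (Ici t) t)
    (bound : ∀ t ∈ Ico a b, ∀ r, B' t < r → ∀ᶠ s in 𝓝[>] t, dist (f t) (f s) ≤ r * (s - t)) :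
    dist (f a) (f b) ≤ B b - B a := by
  have hg : ContinuousOn (fun t => dist (f a) (f t)) (Icc a b) :=
    continuous_dist.comp_continuousOn (continuousOn_const.prodMk hf)
  refine image_le_of_liminf_slope_right_le_deriv_boundary hg (B := fun t => B t - B a) (by simp)
    (hB.sub continuousOn_const) (fun t ht => (hB' t ht).sub_const _) (fun t ht r hr => ?_)
    ⟨hab, le_rfl⟩
  obtain ⟨q, hq, hqr⟩ := exists_between hr
  refine Filter.Eventually.frequently ?_
  filter_upwards [bound t ht q hq, self_mem_nhdsWithin] with s hs hts
  have hpos : 0 < s - t := sub_pos.2 hts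
  refine lt_of_le_of_lt ?_ hqr
  rw [slope_def_field, div_le_iff₀ hpos]
  linarith [dist_triangle (f a) (f t) (f s)]

/-! ### Estimates for the uniformized distance -/

section Estimates

variable {X : Type*} [MetricSpace X]

lemma uniformizationDensity_pos (z₀ : X) (ε : ℝ) (z : X) : 0 < uniformizationDensity z₀ ε z :=
  Real.exp_pos _

lemma uniformizationDensity_le_mul_exp {z₀ : X} {ε : ℝ} (hε : 0 ≤ ε) (x y : X) :
    uniformizationDensity z₀ ε x ≤
      uniformizationDensity z₀ ε y * Real.exp (ε * dist x y) := by
  rw [uniformizationDensity, uniformizationDensity, ← Real.exp_add]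
  refine Real.exp_le_exp.2 ?_
  have := mul_le_mul_of_nonneg_left (dist_triangle y x z₀) hε
  rw [dist_comm y x] at this
  linarith

lemma HasUnitSpeedOn.intervalIntegrable_density {γ : ℝ → X} {L : ℝ} (hL : 0 ≤ L)
    (h : HasUnitSpeedOn γ (Icc 0 L)) (z₀ : X) (ε : ℝ) :
    IntervalIntegrable (fun t => uniformizationDensity z₀ ε (γ t)) MeasureTheory.volume 0 L := by
  refine ContinuousOn.intervalIntegrable ?_
  rw [uIcc_of_le hL]
  exact (continuous_uniformizationDensity z₀ ε).comp_continuousOn h.continuousOn_Icc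

lemma IsGromovHyperbolic.uniformizedDist_le (hX : IsGromovHyperbolic X) (z₀ : X) {ε : ℝ}
    (hε : 0 ≤ ε) (x y : X) : uniformizedDist z₀ ε x y ≤
      dist x y * (uniformizationDensity z₀ ε x * Real.exp (ε * dist x y)) := by
  obtain ⟨γ, hγ⟩ := hX.geodesic x y
  have hu := hγ.hasUnitSpeedOn
  refine (csInf_le (bddBelow_weightedLengths z₀ x y ε)
    ⟨dist x y, γ, dist_nonneg, hu, hγ.1, hγ.2.1, rfl⟩).trans ?_
  have h := intervalIntegral.integral_mono_on (μ := MeasureTheory.volume)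
    (g := fun _ => uniformizationDensity z₀ ε x * Real.exp (ε * dist x y)) dist_nonneg
    (hu.intervalIntegrable_density dist_nonneg z₀ ε) (by simp) fun t ht => by
      refine (uniformizationDensity_le_mul_exp hε (γ t) x).trans ?_
      have h1 := hu.dist_le ⟨le_rfl, dist_nonneg⟩ ht ht.1
      rw [hγ.1, sub_zero, dist_comm] at h1
      have := (uniformizationDensity_pos z₀ ε x).le
      gcongr
      exact h1.trans ht.2
  rwa [intervalIntegral.integral_const, sub_zero, smul_eq_mul] at h

/-- After arc length `t` a path from `x` has density at least `ρ(x) e^{-εt}`. Integrating up to its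
length `L` gives a bound that increases with `L`, and `L ≥ d(x,y)`. -/
lemma IsGromovHyperbolic.le_uniformizedDist (hX : IsGromovHyperbolic X) (z₀ : X) {ε : ℝ}
    (hε : 0 < ε) (x y : X) :
    uniformizationDensity z₀ ε x * (1 - Real.exp (-ε * dist x y)) ≤
      ε * uniformizedDist z₀ ε x y := by
  rw [← div_le_iff₀' hε]
  refine le_csInf (hX.weightedLengths_nonempty z₀ x y ε) ?_
  rintro _ ⟨L, γ, hL, hγ, h0, h1, rfl⟩
  have hd : dist x y ≤ L := by
    have := hγ.dist_le ⟨le_rfl, hL⟩ ⟨hL, le_rfl⟩ hL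
    rwa [h0, h1, sub_zero] at this
  have hp := uniformizationDensity_pos z₀ ε x
  have hint : ∫ t in (0 : ℝ)..L, uniformizationDensity z₀ ε x * Real.exp (-ε * t) =
      uniformizationDensity z₀ ε x * (1 - Real.exp (-ε * L)) / ε := by
    rw [intervalIntegral.integral_const_mul,
      intervalIntegral.integral_comp_mul_left _ (by simpa using hε.ne')]
    simp only [integral_exp, mul_zero, Real.exp_zero, smul_eq_mul]
    field_simp
    ring
  have h2 : uniformizationDensity z₀ ε x * (1 - Real.exp (-ε * dist x y)) / ε ≤
      uniformizationDensity z₀ ε x * (1 - Real.exp (-ε * L)) / ε := by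
    have : Real.exp (-ε * L) ≤ Real.exp (-ε * dist x y) := Real.exp_le_exp.2 (by nlinarith)
    gcongr
  refine h2.trans ?_
  rw [← hint]
  refine intervalIntegral.integral_mono_on hL (Continuous.intervalIntegrable (by fun_prop) _ _)
    (hγ.intervalIntegrable_density hL z₀ ε) fun t ht => ?_
  have h3 := hγ.dist_le ⟨le_rfl, hL⟩ ht ht.1
  rw [h0, sub_zero] at h3
  have h4 := uniformizationDensity_le_mul_exp (z₀ := z₀) hε.le x (γ t)
  have h5 : Real.exp (ε * dist x (γ t)) ≤ Real.exp (ε * t) :=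
    Real.exp_le_exp.2 (mul_le_mul_of_nonneg_left h3 hε.le)
  have h6 := uniformizationDensity_pos z₀ ε (γ t)
  calc _ ≤ uniformizationDensity z₀ ε (γ t) * Real.exp (ε * t) * Real.exp (-ε * t) := by
        gcongr
        exact h4.trans (by gcongr)
    _ = _ := by rw [mul_assoc, ← Real.exp_add]; simp

/-- The density is thus `ε`-Lipschitz for `d_ε`: combine the previous bound with `ρ(x) e^{-ε d(x,y)}
≤ ρ(y)`. -/
lemma IsGromovHyperbolic.density_sub_le (hX : IsGromovHyperbolic X) (z₀ : X) {ε : ℝ}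
    (hε : 0 < ε) (x y : X) :
    uniformizationDensity z₀ ε x - uniformizationDensity z₀ ε y ≤
      ε * uniformizedDist z₀ ε x y := by
  refine le_trans ?_ (hX.le_uniformizedDist z₀ hε x y)
  have h := uniformizationDensity_le_mul_exp (z₀ := z₀) hε.le x y
  have : uniformizationDensity z₀ ε x * Real.exp (-ε * dist x y) ≤
      uniformizationDensity z₀ ε y := by
    calc _ ≤ uniformizationDensity z₀ ε y * Real.exp (ε * dist x y) *
          Real.exp (-ε * dist x y) := by gcongr
      _ = _ := by rw [mul_assoc, ← Real.exp_add]; simp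
  linarith

namespace Uniformization

variable {hX : IsGromovHyperbolic X} {z₀ : X} {ε : ℝ}

lemma dist_eq (x y : Uniformization hX z₀ ε) :
    dist x y = uniformizedDist z₀ ε x.point y.point := rfl

lemma continuous_mk (hε : 0 ≤ ε) : Continuous (Uniformization.mk : X → Uniformization hX z₀ ε) := by
  refine continuous_iff_continuousAt.2 fun x => tendsto_iff_dist_tendsto_zero.2 ?_
  have hc : Continuous fun y =>
      dist x y * (uniformizationDensity z₀ ε x * Real.exp (ε * dist x y)) := by fun_prop
  refine squeeze_zero (fun _ => dist_nonneg) (fun y => ?_) (by simpa using hc.tendsto x)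
  rw [dist_comm]
  exact hX.uniformizedDist_le z₀ hε x y

lemma continuous_point (hε : 0 < ε) :
    Continuous (Uniformization.point : Uniformization hX z₀ ε → X) := by
  refine Metric.continuous_iff'.2 fun x r hr => ?_
  have hp := uniformizationDensity_pos z₀ ε x.point
  have h1 : Real.exp (-ε * r) < 1 := Real.exp_lt_one_iff.2 (by nlinarith)
  have h2 : 0 < uniformizationDensity z₀ ε x.point * (1 - Real.exp (-ε * r)) / ε :=
    div_pos (mul_pos hp (by linarith)) hε
  filter_upwards [Metric.ball_mem_nhds x h2] with y hy
  by_contra! hcon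
  rw [Metric.mem_ball, dist_comm, lt_div_iff₀ hε] at hy
  have h3 := hX.le_uniformizedDist z₀ hε x.point y.point
  have h4 : Real.exp (-ε * dist x.point y.point) ≤ Real.exp (-ε * r) :=
    Real.exp_le_exp.2 (by rw [dist_comm]; nlinarith)
  have h5 := mul_le_mul_of_nonneg_left h4 hp.le
  rw [dist_eq] at hy
  linarith

/-- A bounded subset of the proper space `X` lies in a compact ball, whose image in `X_ε` is again
compact. -/
lemma isComplete_of_isClosed [ProperSpace X] (hε : 0 ≤ ε) {S : Set (Uniformization hX z₀ ε)}
    (hS : IsClosed S) {R : ℝ} (hR : ∀ x ∈ S, dist x.point z₀ ≤ R) : IsComplete S := by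
  have hK := (isCompact_closedBall z₀ R).image
    (continuous_mk (hX := hX) (z₀ := z₀) (ε := ε) hε)
  exact (hK.of_isClosed_subset hS fun x hx => ⟨x.point, hR x hx, rfl⟩).isComplete

end Uniformization

end Estimates

/-! ### The distance to the boundary -/

section Boundary

variable {Z : Type*} [MetricSpace Z]

lemma metricBoundary_nonempty (h : ¬ CompleteSpace Z) : (metricBoundary Z).Nonempty := by
  by_contra hne
  rw [not_nonempty_iff_eq_empty, metricBoundary, compl_empty_iff] at hne
  refine h ((completeSpace_iff_isComplete_range
    (UniformSpace.Completion.isUniformInducing_coe Z)).2 ?_)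
  rw [hne]
  exact isClosed_univ.isComplete

/-- A complete ball has closed image in the completion, so no boundary point can be a limit of its
points. With the converse below, the distance to the boundary is determined by which closed balls
are complete, and later estimates never touch the completion. -/
lemma le_boundaryDist (h : ¬ CompleteSpace Z) {z : Z} {r : ℝ}
    (hr : IsComplete (Metric.closedBall z r)) : r ≤ boundaryDist z := by
  -- Non-completeness matters here: `Metric.infDist` to an empty boundary would be `0`.
  refine (Metric.le_infDist (metricBoundary_nonempty h)).2 fun ξ hξ => ?_
  by_contra! hlt
  refine hξ ?_
  have h1 : IsClosed (((↑) : Z → UniformSpace.Completion Z) '' Metric.closedBall z r) :=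
    (UniformSpace.Completion.isUniformInducing_coe Z).isComplete_iff.2 hr |>.isClosed
  have h2 : ξ ∈ closure (Metric.ball (z : UniformSpace.Completion Z) r ∩
      range ((↑) : Z → UniformSpace.Completion Z)) := by
    refine (UniformSpace.Completion.denseRange_coe (α := Z)).open_subset_closure_inter
      Metric.isOpen_ball ?_
    rwa [Metric.mem_ball, dist_comm]
  refine image_subset_range _ (Metric.closedBall z r) (h1.closure_subset_iff.2 ?_ h2)
  rintro _ ⟨hw, w, rfl⟩
  refine mem_image_of_mem _ ?_
  rw [Metric.mem_ball, UniformSpace.Completion.dist_eq] at hw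
  exact hw.le

lemma isComplete_closedBall_of_lt_boundaryDist {z : Z} {r : ℝ} (hr : r < boundaryDist z) :
    IsComplete (Metric.closedBall z r) := by
  rw [← (UniformSpace.Completion.isUniformInducing_coe Z).isComplete_iff]
  have : ((↑) : Z → UniformSpace.Completion Z) '' Metric.closedBall z r =
      Metric.closedBall (z : UniformSpace.Completion Z) r := by
    ext ξ
    constructor
    · rintro ⟨w, hw, rfl⟩
      rwa [Metric.mem_closedBall, UniformSpace.Completion.dist_eq]
    · intro hξ
      by_cases hm : ξ ∈ metricBoundary Z
      · have h1 := Metric.infDist_le_dist_of_mem (x := (z : UniformSpace.Completion Z)) hm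
        rw [Metric.mem_closedBall, dist_comm] at hξ
        exact absurd (hr.trans_le h1) (not_lt.2 hξ)
      · obtain ⟨w, rfl⟩ := notMem_compl_iff.1 hm
        refine ⟨w, ?_, rfl⟩
        rwa [Metric.mem_closedBall, UniformSpace.Completion.dist_eq] at hξ
  rw [this]
  exact Metric.isClosed_closedBall.isComplete

end Boundary

/-! ### Rescaling -/

section Dilation

variable {W W' : Type*} [MetricSpace W] [MetricSpace W'] {c : ℝ}

lemma dist_symm_of_dilation (e : W ≃ W') (hc : 0 < c)
    (he : ∀ x y, dist (e x) (e y) = c * dist x y) (x y : W') :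
    dist (e.symm x) (e.symm y) = c⁻¹ * dist x y := by
  have := he (e.symm x) (e.symm y)
  rw [e.apply_symm_apply, e.apply_symm_apply] at this
  rw [this, inv_mul_cancel_left₀ hc.ne']

lemma lipschitzWith_of_dilation {e : W → W'} (hc : 0 < c)
    (he : ∀ x y, dist (e x) (e y) = c * dist x y) : LipschitzWith c.toNNReal e :=
  LipschitzWith.of_dist_le_mul fun x y => by rw [he, Real.coe_toNNReal _ hc.le]

lemma isUniformInducing_of_dilation {e : W → W'} (hc : 0 < c)
    (he : ∀ x y, dist (e x) (e y) = c * dist x y) : IsUniformInducing e := by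
  refine AntilipschitzWith.isUniformInducing (K := c⁻¹.toNNReal)
    (AntilipschitzWith.of_le_mul_dist fun x y => ?_)
    (lipschitzWith_of_dilation hc he).uniformContinuous
  rw [he, Real.coe_toNNReal _ (inv_pos.2 hc).le, inv_mul_cancel_left₀ hc.ne']

lemma completeSpace_iff_of_dilation (e : W ≃ W') (hc : 0 < c)
    (he : ∀ x y, dist (e x) (e y) = c * dist x y) : CompleteSpace W ↔ CompleteSpace W' := by
  rw [completeSpace_iff_isComplete_range (isUniformInducing_of_dilation hc he),
    e.surjective.range_eq, completeSpace_iff_isComplete_univ]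

/-- A bijection that multiplies distances by a constant, as a homeomorphism. -/
def homeomorphOfDilation (e : W ≃ W') (hc : 0 < c)
    (he : ∀ x y, dist (e x) (e y) = c * dist x y) : W ≃ₜ W' where
  toEquiv := e
  continuous_toFun := (lipschitzWith_of_dilation hc he).continuous
  continuous_invFun :=
    (lipschitzWith_of_dilation (inv_pos.2 hc) (dist_symm_of_dilation e hc he)).continuous

lemma image_closedBall_of_dilation (e : W ≃ W') (hc : 0 < c)
    (he : ∀ x y, dist (e x) (e y) = c * dist x y) (z : W) (r : ℝ) :
    e '' Metric.closedBall z r = Metric.closedBall (e z) (c * r) := by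
  ext w
  obtain ⟨w, rfl⟩ := e.surjective w
  rw [e.injective.mem_set_image, Metric.mem_closedBall, Metric.mem_closedBall, he,
    mul_le_mul_iff_right₀ hc]

lemma mul_boundaryDist_le_of_dilation (e : W ≃ W') (hc : 0 < c)
    (he : ∀ x y, dist (e x) (e y) = c * dist x y) (h : ¬ CompleteSpace W') (z : W) :
    c * boundaryDist z ≤ boundaryDist (e z) := by
  rw [← le_div_iff₀' hc]
  refine le_of_forall_lt fun r hr => ?_
  obtain ⟨q, hrq, hq⟩ := exists_between hr
  refine hrq.trans_le ((le_div_iff₀' hc).2 (le_boundaryDist h ?_))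
  rw [← image_closedBall_of_dilation e hc he, (isUniformInducing_of_dilation hc he).isComplete_iff]
  exact isComplete_closedBall_of_lt_boundaryDist hq

/-- Lengths, distances and boundary distances all scale by `c`, so the uniformity constant is
unchanged. -/
theorem IsUniformDomain.of_dilation (hW : IsUniformDomain W) (e : W ≃ W') (hc : 0 < c)
    (he : ∀ x y, dist (e x) (e y) = c * dist x y) : IsUniformDomain W' := by
  have hnc : ¬ CompleteSpace W' := fun h =>
    hW.notComplete ((completeSpace_iff_of_dilation e hc he).2 h)
  refine ⟨fun z => ?_, hnc, ?_⟩
  · obtain ⟨z, rfl⟩ := e.surjective z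
    obtain ⟨U, hU, hU'⟩ := hW.locallyComplete z
    exact ⟨e '' U, (homeomorphOfDilation e hc he).isOpenMap.image_mem_nhds hU,
      (isUniformInducing_of_dilation hc he).isComplete_iff.2 hU'⟩
  · obtain ⟨lam, hlam, hu⟩ := hW.uniform
    refine ⟨lam, hlam, fun x y => ?_⟩
    obtain ⟨x, rfl⟩ := e.surjective x
    obtain ⟨y, rfl⟩ := e.surjective y
    obtain ⟨γ, hγ, hγ'⟩ := hu x y
    have hcont := (lipschitzWith_of_dilation hc he).continuous
    have hvar : ∀ S : Set unitInterval,
        eVariationOn (γ.map hcont) S ≤ ENNReal.ofReal c * eVariationOn γ S := fun S =>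
      (lipschitzWith_of_dilation hc he).lipschitzOnWith.comp_eVariationOn_le (mapsTo_univ _ _)
    refine ⟨γ.map hcont, ?_, fun s t hst => ?_⟩
    · refine (hvar univ).trans ((mul_le_mul_right hγ _).trans (le_of_eq ?_))
      rw [← ENNReal.ofReal_mul hc.le, he]
      congr 1
      ring
    · have hst' : γ s = γ t := e.injective hst
      calc _ ≤ ENNReal.ofReal lam⁻¹ * min (ENNReal.ofReal c * eVariationOn γ (Iic s))
            (ENNReal.ofReal c * eVariationOn γ (Ici t)) := by
            gcongr <;> exact hvar _
        _ = ENNReal.ofReal c * (ENNReal.ofReal lam⁻¹ *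
            min (eVariationOn γ (Iic s)) (eVariationOn γ (Ici t))) := by
            rw [← mul_min, mul_left_comm]
        _ ≤ ENNReal.ofReal c * ENNReal.ofReal (boundaryDist (γ s)) := by
            gcongr
            exact hγ' s t hst'
        _ ≤ ENNReal.ofReal (boundaryDist ((γ.map hcont) s)) := by
            rw [← ENNReal.ofReal_mul hc.le]
            exact ENNReal.ofReal_le_ofReal (mul_boundaryDist_le_of_dilation e hc he hnc (γ s))

lemma IsGeodesicPath.of_dilation {e : W → W'} (hc : 0 < c)
    (he : ∀ x y, dist (e x) (e y) = c * dist x y) {γ : ℝ → W} {x y : W}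
    (h : IsGeodesicPath γ x y) : IsGeodesicPath (fun t => e (γ (t / c))) (e x) (e y) := by
  obtain ⟨h0, h1, h2⟩ := h
  have hm : ∀ s ∈ Icc 0 (dist (e x) (e y)), s / c ∈ Icc 0 (dist x y) := fun s hs => by
    rw [he] at hs
    exact ⟨div_nonneg hs.1 hc.le, (div_le_iff₀' hc).2 hs.2⟩
  refine ⟨by simp [h0], ?_, fun s hs t ht => ?_⟩
  · simp only [he, mul_div_cancel_left₀ _ hc.ne', h1]
  · rw [he, h2 _ (hm s hs) _ (hm t ht), ← sub_div, abs_div, abs_of_pos hc,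
      mul_div_cancel₀ _ hc.ne']

lemma image_div_const_Icc_of_pos (hc : 0 < c) (a b : ℝ) :
    (fun t => t / c) '' Icc a b = Icc (a / c) (b / c) := by
  simp only [div_eq_mul_inv]
  exact image_mul_right_Icc' a b (inv_pos.2 hc)

lemma IsGeodesicSegment.of_dilation {e : W → W'} (hc : 0 < c)
    (he : ∀ x y, dist (e x) (e y) = c * dist x y) {S : Set W} {x y : W}
    (h : IsGeodesicSegment S x y) : IsGeodesicSegment (e '' S) (e x) (e y) := by
  obtain ⟨γ, hγ, rfl⟩ := h
  refine ⟨_, hγ.of_dilation hc he, ?_⟩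
  have : (fun t => e (γ (t / c))) = (e ∘ γ) ∘ fun t => t / c := rfl
  rw [this, image_comp, image_comp, image_div_const_Icc_of_pos hc, he, zero_div,
    mul_div_cancel_left₀ _ hc.ne']

theorem IsGromovHyperbolic.of_dilation (hW : IsGromovHyperbolic W) (e : W ≃ W') (hc : 0 < c)
    (he : ∀ x y, dist (e x) (e y) = c * dist x y) : IsGromovHyperbolic W' where
  complete := (completeSpace_iff_of_dilation e hc he).1 hW.complete
  unbounded h := by
    refine hW.unbounded ?_
    obtain ⟨C, hC⟩ := Metric.isBounded_iff.1 h
    refine Metric.isBounded_iff.2 ⟨C / c, fun x _ y _ => ?_⟩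
    rw [le_div_iff₀' hc, ← he]
    exact hC (mem_univ _) (mem_univ _)
  locallyCompact :=
    have := hW.locallyCompact
    (homeomorphOfDilation e hc he).symm.isClosedEmbedding.locallyCompactSpace
  geodesic x y := by
    obtain ⟨x, rfl⟩ := e.surjective x
    obtain ⟨y, rfl⟩ := e.surjective y
    obtain ⟨γ, hγ⟩ := hW.geodesic x y
    exact ⟨_, hγ.of_dilation hc he⟩
  thin := by
    obtain ⟨δ, hδ, h⟩ := hW.thin
    refine ⟨c * δ, by positivity, fun x y z S T U hS hT hU p hp => ?_⟩
    have he' := dist_symm_of_dilation e hc he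
    have hc' := inv_pos.2 hc
    have h1 := h _ _ _ _ _ _ (hS.of_dilation hc' he') (hT.of_dilation hc' he')
      (hU.of_dilation hc' he') (mem_image_of_mem _ hp)
    rw [← image_union] at h1
    simp only [mem_iUnion, Metric.mem_closedBall, exists_prop] at h1 ⊢
    obtain ⟨_, ⟨w, hw, rfl⟩, hd⟩ := h1
    refine ⟨w, hw, ?_⟩
    rwa [he', inv_mul_le_iff₀ hc] at hd

lemma HasUnitSpeedOn.of_dilation {e : W → W'} (hc : 0 < c)
    (he : ∀ x y, dist (e x) (e y) = c * dist x y) {γ : ℝ → W} {L : ℝ}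
    (h : HasUnitSpeedOn γ (Icc 0 L)) :
    HasUnitSpeedOn (fun t => e (γ (t / c))) (Icc 0 (c * L)) := by
  intro s hs t ht
  have hm : ∀ s ∈ Icc 0 (c * L), s / c ∈ Icc 0 L := fun s hs =>
    ⟨div_nonneg hs.1 hc.le, (div_le_iff₀' hc).2 hs.2⟩
  have h1 : ∀ S : Set ℝ, eVariationOn (fun t => e (γ (t / c))) S =
      ENNReal.ofReal c * eVariationOn (γ ∘ fun t => t / c) S := fun S => by
    simp only [eVariationOn, edist_dist, he, ENNReal.ofReal_mul hc.le, ← Finset.mul_sum,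
      ENNReal.mul_iSup, Function.comp_apply]
  rw [h1, eVariationOn.comp_eq_of_monotoneOn γ (t := Icc 0 (c * L) ∩ Icc s t) (fun t => t / c)
    fun a _ b _ hab => div_le_div_of_nonneg_right hab hc.le, Icc_inter_Icc,
    image_div_const_Icc_of_pos hc]
  have h2 := h (hm s hs) (hm t ht)
  rw [Icc_inter_Icc, sup_of_le_right (hm s hs).1, inf_of_le_right (hm t ht).2] at h2
  rw [sup_of_le_right hs.1, inf_of_le_right ht.2, h2, ← ENNReal.ofReal_mul hc.le]
  congr 1
  simp
  field_simp

/-- The density is invariant, since `ε' · (c d) = ε d`, while arc length is multiplied by `c`. -/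
lemma mul_mem_weightedLengths_of_dilation {e : W → W'} (hc : 0 < c)
    (he : ∀ x y, dist (e x) (e y) = c * dist x y) {z₀ x y : W} {ε ε' s : ℝ} (hε : ε = c * ε')
    (hs : s ∈ weightedLengths z₀ ε x y) : c * s ∈ weightedLengths (e z₀) ε' (e x) (e y) := by
  obtain ⟨L, γ, hL, hγ, h0, h1, rfl⟩ := hs
  refine ⟨c * L, fun t => e (γ (t / c)), by positivity, hγ.of_dilation hc he, by simp [h0], ?_, ?_⟩
  · simp only [mul_div_cancel_left₀ _ hc.ne', h1]
  · have hρ : ∀ z, uniformizationDensity (e z₀) ε' (e z) = uniformizationDensity z₀ ε z :=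
      fun z => by
        rw [uniformizationDensity, uniformizationDensity, he, hε]
        congr 1
        ring
    simp only [hρ]
    rw [intervalIntegral.integral_comp_div (fun t => uniformizationDensity z₀ ε (γ t)) hc.ne',
      zero_div, mul_div_cancel_left₀ _ hc.ne', smul_eq_mul]

lemma uniformizedDist_of_dilation (e : W ≃ W') (hc : 0 < c)
    (he : ∀ x y, dist (e x) (e y) = c * dist x y) (z₀ x y : W) {ε ε' : ℝ} (hε : ε = c * ε') :
    uniformizedDist (e z₀) ε' (e x) (e y) = c * uniformizedDist z₀ ε x y := by
  have : weightedLengths (e z₀) ε' (e x) (e y) = c • weightedLengths z₀ ε x y := by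
    refine Subset.antisymm (fun s hs => ?_) ?_
    · refine ⟨c⁻¹ * s, ?_, mul_inv_cancel_left₀ hc.ne' s⟩
      simpa using mul_mem_weightedLengths_of_dilation (inv_pos.2 hc)
        (dist_symm_of_dilation e hc he) (ε' := ε) (by rw [hε, inv_mul_cancel_left₀ hc.ne']) hs
    · rintro _ ⟨s, hs, rfl⟩
      exact mul_mem_weightedLengths_of_dilation hc he hε hs
  rw [uniformizedDist, this, Real.sInf_smul_of_nonneg hc.le, smul_eq_mul, uniformizedDist]

end Dilation

section Rescaled

variable {X : Type*} [MetricSpace X] {c : ℝ}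

/-- The identity map from a space to its rescaled copy. -/
def Rescaled.equiv (hc : 0 < c) (X : Type*) : X ≃ Rescaled hc X where
  toFun x := ⟨x⟩
  invFun x := x.point

lemma Rescaled.dist_equiv (hc : 0 < c) (x y : X) :
    dist (Rescaled.equiv hc X x) (Rescaled.equiv hc X y) = c * dist x y := rfl

theorem Rescaled.isRoughSimilarity (hc : 0 < c) :
    IsRoughSimilarity c 0 (Rescaled.equiv hc X) where
  pos := hc
  nonneg := le_rfl
  lower x y := by rw [Rescaled.dist_equiv, sub_zero]
  upper x y := by rw [Rescaled.dist_equiv, add_zero]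
  hausdorff := by rw [(Rescaled.equiv hc X).surjective.range_eq, Metric.hausdorffEDist_self]; simp

theorem IsGromovHyperbolic.rescaled (hX : IsGromovHyperbolic X) (hc : 0 < c) :
    IsGromovHyperbolic (Rescaled hc X) :=
  hX.of_dilation (Rescaled.equiv hc X) hc (Rescaled.dist_equiv hc)

/-- The identity map from a uniformization of `X` to a uniformization of its rescaled copy. -/
def Uniformization.rescaledEquiv (hX : IsGromovHyperbolic X) (hc : 0 < c) (z₀ : X) (ε ε' : ℝ) :
    Uniformization hX z₀ ε ≃ Uniformization (hX.rescaled hc) ⟨z₀⟩ ε' where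
  toFun x := ⟨⟨x.point⟩⟩
  invFun x := ⟨x.point.point⟩

lemma Uniformization.dist_rescaledEquiv (hX : IsGromovHyperbolic X) (hc : 0 < c) (z₀ : X)
    {ε ε' : ℝ} (hε : ε = c * ε') (x y : Uniformization hX z₀ ε) :
    dist (rescaledEquiv hX hc z₀ ε ε' x) (rescaledEquiv hX hc z₀ ε ε' y) = c * dist x y :=
  uniformizedDist_of_dilation (Rescaled.equiv hc X) hc (Rescaled.dist_equiv hc) z₀ _ _ hε

end Rescaled

/-! ### Uniformizations of the hyperbolic disk -/

namespace HypDisk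

/-! #### Weighted lengths of curves -/

/-- The infinitesimal upper bound for `d_ε` by the line element `ρ_ε |dz| / (1 - |z|²)`, with any
slack allowed in the factor. -/
lemma eventually_uniformizedDist_le (hY : IsGromovHyperbolic HypDisk) {ε : ℝ} (hε : 0 ≤ ε)
    (z : HypDisk) {q : ℝ}
    (hq : uniformizationDensity 0 ε z / (1 - ‖z.toComplex‖ ^ 2) < q) :
    ∀ᶠ w in 𝓝 z, uniformizedDist 0 ε z w ≤ q * ‖z.toComplex - w.toComplex‖ := by
  have hz := z.one_sub_sq_pos
  have hsq : √((1 - ‖z.toComplex‖ ^ 2) * (1 - ‖z.toComplex‖ ^ 2)) = 1 - ‖z.toComplex‖ ^ 2 :=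
    Real.sqrt_mul_self hz.le
  have hc : ContinuousAt (fun w : HypDisk => uniformizationDensity 0 ε z * Real.exp (ε * dist z w) /
      √((1 - ‖z.toComplex‖ ^ 2) * (1 - ‖w.toComplex‖ ^ 2))) z := by
    have := continuous_toComplex
    refine ContinuousAt.div (by fun_prop) (by fun_prop) ?_
    rw [hsq]
    exact hz.ne'
  filter_upwards [hc.tendsto.eventually_lt_const (u := q) (by simpa [hsq] using hq)] with w hw
  refine (hY.uniformizedDist_le 0 hε z w).trans ?_
  calc _ ≤ ‖z.toComplex - w.toComplex‖ /
          √((1 - ‖z.toComplex‖ ^ 2) * (1 - ‖w.toComplex‖ ^ 2)) *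
        (uniformizationDensity 0 ε z * Real.exp (ε * dist z w)) := by
        have := (uniformizationDensity_pos 0 ε z).le
        gcongr
        exact dist_le_norm_div z w
    _ = uniformizationDensity 0 ε z * Real.exp (ε * dist z w) /
          √((1 - ‖z.toComplex‖ ^ 2) * (1 - ‖w.toComplex‖ ^ 2)) *
        ‖z.toComplex - w.toComplex‖ := by ring
    _ ≤ _ := mul_le_mul_of_nonneg_right hw.le (norm_nonneg _)

lemma uniformizedDist_le_of_curve (hY : IsGromovHyperbolic HypDisk) {ε : ℝ} (hε : 0 ≤ ε)
    {f : ℝ → HypDisk} {a b K M : ℝ} (hab : a ≤ b) (hK : 0 ≤ K)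
    (hf : ∀ s ∈ Icc a b, ∀ t ∈ Icc a b, ‖(f s).toComplex - (f t).toComplex‖ ≤ K * |s - t|)
    (hM : ∀ t ∈ Icc a b, uniformizationDensity 0 ε (f t) / (1 - ‖(f t).toComplex‖ ^ 2) ≤ M) :
    uniformizedDist 0 ε (f a) (f b) ≤ M * K * (b - a) := by
  have hcont : ContinuousOn f (Icc a b) := by
    refine isInducing_toComplex.continuousOn_iff.2 ?_
    refine LipschitzOnWith.continuousOn (K := K.toNNReal) (LipschitzOnWith.of_dist_le_mul ?_)
    intro s hs t ht
    rw [Real.coe_toNNReal _ hK, Real.dist_eq]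
    exact (dist_eq_norm _ _).trans_le (hf s hs t ht)
  have key := dist_le_sub_of_local_bound
    (f := fun t => (⟨f t⟩ : Uniformization hY 0 ε)) (B := fun t => M * K * t)
    (B' := fun _ => M * K) hab ((Uniformization.continuous_mk hε).comp_continuousOn hcont)
    (by fun_prop) (fun t _ => by simpa using ((hasDerivAt_id t).const_mul (M * K)).hasDerivWithinAt)
    (fun t ht r hr => ?_)
  · rw [← mul_sub] at key
    exact key
  · have ht' : t ∈ Icc a b := Ico_subset_Icc_self ht
    -- The denominator `K + 1` keeps the slack positive and finite when `K = 0`; the factor so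
    -- obtained exceeds `M`, yet its product with `K` is at most `r`.
    have hq : M < M + (r - M * K) / (K + 1) :=
      lt_add_of_pos_right _ (div_pos (sub_pos.2 hr) (by linarith))
    have hqr : (M + (r - M * K) / (K + 1)) * K ≤ r := by
      have : (r - M * K) / (K + 1) * K ≤ r - M * K := by
        rw [div_mul_eq_mul_div, div_le_iff₀ (by linarith)]
        nlinarith
      linarith
    have htend : Filter.Tendsto f (𝓝[>] t) (𝓝 (f t)) :=
      (hcont t ht').mono_left (nhdsWithin_le_of_mem (Icc_mem_nhdsGT_of_mem ht))
    filter_upwards [htend.eventually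
      (eventually_uniformizedDist_le hY hε (f t) ((hM t ht').trans_lt hq)),
      Icc_mem_nhdsGT_of_mem ht, self_mem_nhdsWithin] with s hs hsI hts
    have hpos : 0 < s - t := sub_pos.2 hts
    have h1 := hf t ht' s hsI
    rw [abs_sub_comm, abs_of_pos hpos] at h1
    have hM0 : 0 ≤ M := (div_nonneg (uniformizationDensity_pos 0 ε (f t)).le
      (f t).one_sub_sq_pos.le).trans (hM t ht')
    calc _ ≤ _ := hs
      _ ≤ (M + (r - M * K) / (K + 1)) * (K * (s - t)) :=
        mul_le_mul_of_nonneg_left h1 (by linarith)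
      _ = (M + (r - M * K) / (K + 1)) * K * (s - t) := by ring
      _ ≤ r * (s - t) := mul_le_mul_of_nonneg_right hqr hpos.le

/-! #### Radial rays -/

lemma uniformizedDist_polar_le {ε : ℝ} (hε : 0 < ε) {u : ℂ} (hu : ‖u‖ = 1) {s t : ℝ}
    (hs : 0 ≤ s) (hst : s ≤ t) : uniformizedDist 0 ε (polar u s) (polar u t) ≤
      (Real.exp (-ε * s) - Real.exp (-ε * t)) / ε := by
  have hd : dist (polar u s) (polar u t) = t - s := by
    rw [dist_polar hu, abs_sub_comm, abs_of_nonneg (sub_nonneg.2 hst)]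
  have hgeo : IsGeodesicPath (fun τ => polar u (s + τ)) (polar u s) (polar u t) :=
    ⟨by simp, by simp [hd], fun a _ b _ => by rw [dist_polar hu]; congr 1; ring⟩
  refine (csInf_le (bddBelow_weightedLengths _ _ _ _)
    ⟨_, _, dist_nonneg, hgeo.hasUnitSpeedOn, hgeo.1, hgeo.2.1, rfl⟩).trans (le_of_eq ?_)
  have h1 : ∀ τ ∈ uIcc 0 (dist (polar u s) (polar u t)),
      uniformizationDensity 0 ε (polar u (s + τ)) = Real.exp (-ε * (s + τ)) := fun τ hτ => by
    rw [uIcc_of_le dist_nonneg] at hτ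
    rw [uniformizationDensity, dist_polar_zero hu (by linarith [hτ.1])]
  rw [intervalIntegral.integral_congr h1, hd,
    intervalIntegral.integral_comp_add_left (fun τ => Real.exp (-ε * τ)),
    intervalIntegral.integral_comp_mul_left _ (by simpa using hε.ne')]
  simp only [integral_exp, add_zero, add_sub_cancel, smul_eq_mul]
  field_simp
  ring

lemma density_polar {ε : ℝ} {u : ℂ} (hu : ‖u‖ = 1) {t : ℝ} (ht : 0 ≤ t) :
    uniformizationDensity 0 ε (polar u t) = Real.exp (-ε * t) := by
  rw [uniformizationDensity, dist_polar_zero hu ht]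

/-- The radial ray outward from `z` has total `d_ε`-length `ρ(z) / ε`, so it stays in the ball and
its points form a Cauchy sequence. A limit would be at finite hyperbolic distance from the centre,
but the ray goes to infinity. -/
lemma not_isComplete_closedBall {hY : IsGromovHyperbolic HypDisk} {ε : ℝ} (hε : 0 < ε)
    (z : Uniformization hY 0 ε) {r : ℝ} (hr : uniformizationDensity 0 ε z.point / ε ≤ r) :
    ¬ IsComplete (Metric.closedBall z r) := by
  intro hcomp
  obtain ⟨u, hu, hz⟩ := exists_polar z.point
  set R := dist z.point 0 with hR
  have hR0 : 0 ≤ R := dist_nonneg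
  have hle : ∀ s t : ℝ, 0 ≤ s → s ≤ t →
      uniformizedDist 0 ε (polar u s) (polar u t) ≤ Real.exp (-ε * s) / ε := fun s t hs hst =>
    (uniformizedDist_polar_le hε hu hs hst).trans
      (by gcongr; linarith [Real.exp_pos (-ε * t)])
  let a : ℕ → Uniformization hY 0 ε := fun n => ⟨polar u (R + n)⟩
  have hmem : ∀ n, a n ∈ Metric.closedBall z r := fun n => by
    rw [Metric.mem_closedBall, dist_comm, Uniformization.dist_eq, ← hz]
    refine (hle R _ hR0 (by simp)).trans (le_trans (le_of_eq ?_) hr)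
    rw [uniformizationDensity]
  have hmono : ∀ N n m : ℕ, N ≤ n → n ≤ m → dist (a n) (a m) ≤ Real.exp (-ε * (R + N)) / ε :=
    fun N n m hNn hnm => by
      refine (hle _ _ (by positivity) (by simpa using hnm)).trans ?_
      have : (N : ℝ) ≤ n := by exact_mod_cast hNn
      gcongr ?_ / ε
      exact Real.exp_le_exp.2 (by nlinarith)
  have hcau : CauchySeq a := by
    refine cauchySeq_of_le_tendsto_0 (fun N : ℕ => Real.exp (-ε * (R + N)) / ε) ?_ ?_
    · intro n m N hn hm
      rcases le_total n m with h | h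
      · exact hmono N n m hn h
      · rw [dist_comm]; exact hmono N m n hm h
    · have h1 : Filter.Tendsto (fun N : ℕ => -ε * (R + N)) Filter.atTop Filter.atBot :=
        (Filter.tendsto_atTop_add_const_left _ R tendsto_natCast_atTop_atTop).const_mul_atTop_of_neg
          (neg_lt_zero.2 hε)
      simpa using (Real.tendsto_exp_atBot.comp h1).div_const ε
  obtain ⟨v, -, hv⟩ := cauchySeq_tendsto_of_isComplete hcomp hmem hcau
  have h2 := (((Uniformization.continuous_point hε).tendsto v).comp hv).dist
    (tendsto_const_nhds (x := (0 : HypDisk)))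
  have h3 : (fun n : ℕ => dist ((Uniformization.point ∘ a) n) 0) = fun n : ℕ => R + n := by
    funext n
    exact dist_polar_zero hu (by positivity)
  rw [h3] at h2
  exact not_tendsto_nhds_of_tendsto_atTop
    (Filter.tendsto_atTop_add_const_left _ R tendsto_natCast_atTop_atTop) _ h2

lemma not_completeSpace_uniformization (hY : IsGromovHyperbolic HypDisk) {ε : ℝ} (hε : 0 < ε) :
    ¬ CompleteSpace (Uniformization hY 0 ε) := fun _ =>
  not_isComplete_closedBall hε ⟨0⟩ le_rfl Metric.isClosed_closedBall.isComplete

lemma boundaryDist_le {hY : IsGromovHyperbolic HypDisk} {ε : ℝ} (hε : 0 < ε)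
    (z : Uniformization hY 0 ε) : boundaryDist z ≤ uniformizationDensity 0 ε z.point / ε :=
  not_lt.1 fun h => not_isComplete_closedBall hε z le_rfl
    (isComplete_closedBall_of_lt_boundaryDist h)

/-! #### The parameter two: comparison with the Euclidean metric -/

lemma density_two (z : HypDisk) : uniformizationDensity 0 2 z =
    (1 - ‖z.toComplex‖) / (1 + ‖z.toComplex‖) := exp_neg_two_mul_dist z

/-- The quotient is `1 / (1 + |z|)²`. The bound `1` here and the bound `1/4` in the next lemma are
the two bi-Lipschitz constants. -/
lemma density_two_div_le (z : HypDisk) :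
    uniformizationDensity 0 2 z / (1 - ‖z.toComplex‖ ^ 2) ≤ 1 := by
  have h0 := norm_nonneg z.toComplex
  rw [div_le_one z.one_sub_sq_pos, density_two, div_le_iff₀ (by linarith)]
  have := z.norm_lt_one
  nlinarith [mul_nonneg h0 (sub_pos.2 this).le, mul_nonneg h0 z.one_sub_sq_pos.le]

lemma one_sub_sq_le_density_two (z : HypDisk) :
    1 - ‖z.toComplex‖ ^ 2 ≤ 4 * uniformizationDensity 0 2 z := by
  have h0 := norm_nonneg z.toComplex
  have h1 := z.norm_lt_one
  rw [density_two, mul_div_assoc', le_div_iff₀ (by linarith)]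
  nlinarith [mul_nonneg h0 (sub_pos.2 h1).le, mul_nonneg (mul_nonneg h0 h0) (sub_pos.2 h1).le]

lemma uniformizedDist_two_le (hY : IsGromovHyperbolic HypDisk) (z w : HypDisk) :
    uniformizedDist 0 2 z w ≤ ‖z.toComplex - w.toComplex‖ := by
  set ℓ : ℝ → ℂ := fun t => z.toComplex + t • (w.toComplex - z.toComplex) with hℓ
  have hn : ∀ t ∈ Icc (0 : ℝ) 1, ‖ℓ t‖ < 1 := fun t ht => by
    have := (convex_ball (0 : ℂ) 1).add_smul_sub_mem (x := z.toComplex) (y := w.toComplex)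
      (by simpa using z.norm_lt_one) (by simpa using w.norm_lt_one) ht
    simpa only [mem_ball_zero_iff] using this
  have h := uniformizedDist_le_of_curve hY (ε := 2) (by norm_num)
    (f := fun t => ofComplex (ℓ t)) (a := 0) (b := 1) (K := ‖z.toComplex - w.toComplex‖) (M := 1)
    zero_le_one (norm_nonneg _) (fun s hs t ht => ?_) fun t _ => density_two_div_le _
  · simpa [hℓ, ofComplex_toComplex] using h
  · rw [toComplex_ofComplex (hn s hs), toComplex_ofComplex (hn t ht)]
    have : ℓ s - ℓ t = (s - t) • (w.toComplex - z.toComplex) := by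
      simp only [hℓ]; rw [sub_smul]; ring
    rw [this, norm_smul, norm_sub_rev w.toComplex, Real.norm_eq_abs, mul_comm]

/-- A path of unit hyperbolic speed has Euclidean speed at most `1 - |γ|²`, hence at most four times
the density; the mean value inequality integrates this. -/
lemma norm_sub_le_uniformizedDist_two (hY : IsGromovHyperbolic HypDisk) (z w : HypDisk) :
    ‖z.toComplex - w.toComplex‖ ≤ 4 * uniformizedDist 0 2 z w := by
  rw [← div_le_iff₀' (by norm_num)]
  refine le_csInf (hY.weightedLengths_nonempty 0 z w 2) ?_
  rintro _ ⟨L, γ, hL, hγ, h0, h1, rfl⟩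
  -- Extending the density by constants makes it continuous on the whole line, so its primitive is
  -- differentiable at the end points too.
  set g : ℝ → ℝ := IccExtend hL ((Icc 0 L).domRestrict fun t => uniformizationDensity 0 2 (γ t))
  have hg : Continuous g :=
    (((continuous_uniformizationDensity 0 2).comp_continuousOn
      hγ.continuousOn_Icc).domRestrict).Icc_extend'
  have hgeq : ∀ t ∈ Icc 0 L, g t = uniformizationDensity 0 2 (γ t) := fun t ht =>
    IccExtend_of_mem hL _ ht
  have hder : ∀ t, HasDerivAt (fun t => 4 * ∫ τ in (0 : ℝ)..t, g τ) (4 * g t) t := fun t =>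
    (hg.integral_hasStrictDerivAt 0 t).hasDerivAt.const_mul 4
  have key := dist_le_sub_of_local_bound (f := fun t => (γ t).toComplex)
    (B := fun t => 4 * ∫ τ in (0 : ℝ)..t, g τ) (B' := fun t => 4 * g t) hL
    (continuous_toComplex.comp_continuousOn hγ.continuousOn_Icc)
    (fun t _ => (hder t).continuousAt.continuousWithinAt) (fun t _ => (hder t).hasDerivWithinAt)
    (fun t ht r hr => ?_)
  · have hint : ∫ τ in (0 : ℝ)..L, g τ =
        ∫ τ in (0 : ℝ)..L, uniformizationDensity 0 2 (γ τ) :=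
      intervalIntegral.integral_congr fun τ hτ => hgeq τ (by rwa [uIcc_of_le hL] at hτ)
    simp only [h0, h1, hint, dist_eq_norm, intervalIntegral.integral_same] at key
    linarith
  · have ht' : t ∈ Icc 0 L := Ico_subset_Icc_self ht
    simp only [hgeq t ht'] at hr
    have htend : Filter.Tendsto γ (𝓝[>] t) (𝓝 (γ t)) :=
      (hγ.continuousOn_Icc t ht').mono_left (nhdsWithin_le_of_mem (Icc_mem_nhdsGT_of_mem ht))
    have hc : Continuous fun w : HypDisk =>
        ‖1 - (starRingEnd ℂ) w.toComplex * (γ t).toComplex‖ := by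
      have := continuous_toComplex
      have := Complex.continuous_conj
      fun_prop
    have hval : ‖1 - (starRingEnd ℂ) (γ t).toComplex * (γ t).toComplex‖ < r := by
      have h2 := normSq_identity (γ t).toComplex (γ t).toComplex
      rw [sub_self, norm_zero, zero_pow two_ne_zero, sub_zero, ← sq] at h2
      rw [(sq_eq_sq₀ (norm_nonneg _) (γ t).one_sub_sq_pos.le).1 h2]
      exact (one_sub_sq_le_density_two _).trans_lt hr
    filter_upwards [htend.eventually (hc.continuousAt.eventually_lt_const hval),
      Icc_mem_nhdsGT_of_mem ht, self_mem_nhdsWithin] with s hs hsI hts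
    have hd := hγ.dist_le ht' hsI (le_of_lt hts)
    rw [dist_eq_norm]
    refine (norm_sub_le_mul_dist _ _).trans ?_
    exact mul_le_mul hs.le hd dist_nonneg ((norm_nonneg _).trans hs.le)

end HypDisk

/-! ### Uniform curves in the uniformization with parameter two. -/

lemma eVariationOn_Icc_le_of_lipschitz {M : Type*} [MetricSpace M] {F : unitInterval → M} {K : ℝ}
    (hK : 0 ≤ K) (hF : ∀ s t, dist (F s) (F t) ≤ K * |(s : ℝ) - t|) {a b : unitInterval}
    (hab : a ≤ b) : eVariationOn F (Icc a b) ≤ ENNReal.ofReal (K * (b - a)) := by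
  have hl : LipschitzWith K.toNNReal F := LipschitzWith.of_dist_le_mul fun s t => by
    rw [Real.coe_toNNReal _ hK]; exact hF s t
  have h1 := hl.lipschitzOnWith.comp_eVariationOn_le (g := id) (mapsTo_univ _ (Icc a b))
  have h2 : eVariationOn (id : unitInterval → unitInterval) (Icc a b) ≤
      ENNReal.ofReal ((b : ℝ) - a) := by
    have h3 := MonotoneOn.eVariationOn_eq (f := ((↑) : unitInterval → ℝ)) (s := Icc a b)
      (fun _ _ _ _ h => h) (left_mem_Icc.2 hab) (right_mem_Icc.2 hab)
    rw [inter_self] at h3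
    exact h3.le
  rw [ENNReal.ofReal_mul hK]
  exact h1.trans (mul_le_mul_right h2 _)

namespace HypDisk

/-- Points of such a ball have modulus at most `|z| + 4r < 1`, so the ball is bounded in the
hyperbolic metric. -/
lemma isComplete_closedBall_two {hY : IsGromovHyperbolic HypDisk} (z : Uniformization hY 0 2)
    {r : ℝ} (hr : r < (1 - ‖z.point.toComplex‖) / 4) : IsComplete (Metric.closedBall z r) := by
  refine Uniformization.isComplete_of_isClosed (by norm_num) Metric.isClosed_closedBall
    (R := Real.artanh (‖z.point.toComplex‖ + 4 * r)) fun x hx => ?_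
  have h1 := norm_sub_le_uniformizedDist_two hY x.point z.point
  rw [Metric.mem_closedBall, Uniformization.dist_eq] at hx
  have h2 := norm_le_norm_add_norm_sub' x.point.toComplex z.point.toComplex
  rw [dist_zero_right]
  exact Real.artanh_le_artanh (by linarith [norm_nonneg x.point.toComplex]) (by linarith)
    (by linarith)

lemma le_boundaryDist_two {hY : IsGromovHyperbolic HypDisk} (z : Uniformization hY 0 2) :
    (1 - ‖z.point.toComplex‖) / 4 ≤ boundaryDist z := by
  refine le_of_forall_lt fun r hr => ?_
  obtain ⟨q, hrq, hq⟩ := exists_between hr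
  exact hrq.trans_le (le_boundaryDist (not_completeSpace_uniformization hY (by norm_num))
    (isComplete_closedBall_two z hq))

/-- The segment from `a` to `b`, pushed towards the centre in proportion to `‖a - b‖`. -/
noncomputable def bentSegment (a b : ℂ) (t : ℝ) : ℂ :=
  (1 - ‖a - b‖ * (t * (1 - t))) • (a + t • (b - a))

section BentSegment

variable {a b : ℂ}

lemma bentSegment_zero : bentSegment a b 0 = a := by simp [bentSegment]

lemma bentSegment_one : bentSegment a b 1 = b := by simp [bentSegment]

lemma bentSegment_factor_mem (ha : ‖a‖ < 1) (hb : ‖b‖ < 1) {t : ℝ} (ht : t ∈ Icc (0 : ℝ) 1) :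
    1 - ‖a - b‖ * (t * (1 - t)) ∈ Icc (0 : ℝ) 1 := by
  have h1 : ‖a - b‖ ≤ 2 := (norm_sub_le a b).trans (by linarith)
  have h2 : 0 ≤ t * (1 - t) := mul_nonneg ht.1 (by linarith [ht.2])
  have h3 : t * (1 - t) ≤ 1 / 4 := by nlinarith [sq_nonneg (t - 1 / 2)]
  constructor <;> nlinarith [norm_nonneg (a - b)]

lemma norm_segment_lt_one (ha : ‖a‖ < 1) (hb : ‖b‖ < 1) {t : ℝ} (ht : t ∈ Icc (0 : ℝ) 1) :
    ‖a + t • (b - a)‖ < 1 := by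
  have := (convex_ball (0 : ℂ) 1).add_smul_sub_mem (x := a) (y := b)
    (by simpa using ha) (by simpa using hb) ht
  simpa only [mem_ball_zero_iff] using this

lemma norm_bentSegment_le (ha : ‖a‖ < 1) (hb : ‖b‖ < 1) {t : ℝ} (ht : t ∈ Icc (0 : ℝ) 1) :
    ‖bentSegment a b t‖ ≤ 1 - ‖a - b‖ * (t * (1 - t)) := by
  have h := (bentSegment_factor_mem ha hb ht).1
  rw [bentSegment, norm_smul, Real.norm_eq_abs, abs_of_nonneg h]
  exact mul_le_of_le_one_right h (norm_segment_lt_one ha hb ht).le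

lemma norm_bentSegment_lt_one (ha : ‖a‖ < 1) (hb : ‖b‖ < 1) {t : ℝ} (ht : t ∈ Icc (0 : ℝ) 1) :
    ‖bentSegment a b t‖ < 1 := by
  have h := bentSegment_factor_mem ha hb ht
  rw [bentSegment, norm_smul, Real.norm_eq_abs, abs_of_nonneg h.1]
  exact (mul_le_of_le_one_left (norm_nonneg _) h.2).trans_lt (norm_segment_lt_one ha hb ht)

/-- One `‖a - b‖` is the speed of the straight segment, the other bounds the derivative `‖a - b‖ (1
- 2t)` of the bending factor. -/
lemma norm_bentSegment_sub_le (ha : ‖a‖ < 1) (hb : ‖b‖ < 1) {s t : ℝ} (hs : s ∈ Icc (0 : ℝ) 1)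
    (ht : t ∈ Icc (0 : ℝ) 1) :
    ‖bentSegment a b s - bentSegment a b t‖ ≤ 2 * ‖a - b‖ * |s - t| := by
  have e : bentSegment a b s - bentSegment a b t =
      (‖a - b‖ * (s - t) * (s + t - 1)) • (a + s • (b - a)) +
        (1 - ‖a - b‖ * (t * (1 - t))) • ((s - t) • (b - a)) := by
    simp only [bentSegment, Complex.real_smul]
    push_cast
    ring
  have h1 : |s + t - 1| ≤ 1 := abs_le.2 ⟨by linarith [hs.1, ht.1], by linarith [hs.2, ht.2]⟩
  have h2 := bentSegment_factor_mem ha hb ht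
  rw [e]
  refine (norm_add_le _ _).trans ?_
  rw [norm_smul, norm_smul, norm_smul, norm_mul, norm_mul, norm_norm, Real.norm_eq_abs,
    Real.norm_eq_abs, Real.norm_eq_abs, abs_of_nonneg h2.1, norm_sub_rev b a]
  have h3 : ‖a - b‖ * |s - t| * |s + t - 1| * ‖a + s • (b - a)‖ ≤ ‖a - b‖ * |s - t| * 1 * 1 := by
    gcongr
    exact (norm_segment_lt_one ha hb hs).le
  have h4 : (1 - ‖a - b‖ * (t * (1 - t))) * (|s - t| * ‖a - b‖) ≤ 1 * (|s - t| * ‖a - b‖) := by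
    gcongr
    exact h2.2
  linarith

/-- Where the bent segment visits a point at the times `s` and `t`, it is far from the unit circle
in comparison with `min s (1 - t)`. -/
lemma mul_min_le_of_bentSegment_eq (ha : ‖a‖ < 1) (hb : ‖b‖ < 1) {s t : ℝ}
    (hs : s ∈ Icc (0 : ℝ) 1) (ht : t ∈ Icc (0 : ℝ) 1)
    (hst : bentSegment a b s = bentSegment a b t) :
    ‖a - b‖ * min s (1 - t) ≤ 8 * (1 - ‖bentSegment a b s‖) := by
  have n1 := norm_bentSegment_le ha hb hs
  have n2 := norm_bentSegment_le ha hb ht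
  rw [← hst] at n2
  set r := ‖a - b‖ with hr
  rcases (norm_nonneg (a - b)).eq_or_lt with h0 | h0
  · rw [← hr] at h0
    rw [← h0, zero_mul]
    linarith [norm_bentSegment_lt_one ha hb hs]
  have m1 := min_le_left s (1 - t)
  have m2 := min_le_right s (1 - t)
  have m3 : min s (1 - t) ≤ 1 := m1.trans hs.2
  -- The curve may pass through a point twice, so `s ≠ t` is possible. The hard case is `t ≤ 1/2 ≤
  -- s`: the common point is within `2rt` of `a` and `2r(1 - s)` of `b`, so `t + (1 - s) ≥ 1/2` and
  -- one summand is at least `1/4`. Then `t(1 - t)` or `s(1 - s)` is at least `1/8`, whence the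
  -- factor `8`.
  have key : min s (1 - t) ≤ 8 * (s * (1 - s)) ∨ min s (1 - t) ≤ 8 * (t * (1 - t)) := by
    rcases le_total s (1 / 2) with h1 | h1
    · left; nlinarith [hs.1]
    rcases le_total (1 / 2) t with h2 | h2
    · right; nlinarith [ht.2]
    have l1 := norm_bentSegment_sub_le ha hb hs (right_mem_Icc.2 zero_le_one)
    have l2 := norm_bentSegment_sub_le ha hb (left_mem_Icc.2 zero_le_one) ht
    rw [bentSegment_one, abs_of_nonpos (by linarith [hs.2])] at l1
    rw [bentSegment_zero, ← hst, abs_of_nonpos (by linarith [ht.1])] at l2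
    have l3 := norm_sub_le_norm_sub_add_norm_sub a (bentSegment a b s) b
    rw [← hr] at l1 l2 l3
    have l4 : 1 / 2 ≤ (1 - s) + t := by
      by_contra! hcon
      nlinarith
    rcases le_total (1 / 4) (1 - s) with h3 | h3
    · left; nlinarith
    · right; nlinarith
  rcases key with h | h
  · nlinarith [mul_le_mul_of_nonneg_left h h0.le]
  · nlinarith [mul_le_mul_of_nonneg_left h h0.le]

end BentSegment

/-- With the parameter two, the uniformization is comparable to the Euclidean disk. -/
theorem isUniformDomain_two (hY : IsGromovHyperbolic HypDisk) :
    IsUniformDomain (Uniformization hY 0 2) := by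
  -- `64 = 2 · 8 · 4`: speed `2r`, the factor `8` of `mul_min_le_of_bentSegment_eq`, and the
  -- comparison of boundary distances. The length condition alone needs only `2 · 4`.
  refine ⟨fun z => ?_, not_completeSpace_uniformization hY (by norm_num), 64, by norm_num,
    fun x y => ?_⟩
  · have h := z.point.norm_lt_one
    exact ⟨Metric.closedBall z ((1 - ‖z.point.toComplex‖) / 8),
      Metric.closedBall_mem_nhds z (by linarith), isComplete_closedBall_two z (by linarith)⟩
  set a := x.point.toComplex with ha'
  set b := y.point.toComplex with hb'
  have ha : ‖a‖ < 1 := x.point.norm_lt_one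
  have hb : ‖b‖ < 1 := y.point.norm_lt_one
  set r := ‖a - b‖ with hr
  have hr0 : 0 ≤ r := norm_nonneg _
  let F : unitInterval → Uniformization hY 0 2 := fun t => ⟨ofComplex (bentSegment a b t)⟩
  have hFc : ∀ t, (F t).point.toComplex = bentSegment a b t := fun t =>
    toComplex_ofComplex (norm_bentSegment_lt_one ha hb t.2)
  have hF : ∀ s t, dist (F s) (F t) ≤ 2 * r * |(s : ℝ) - t| := fun s t => by
    refine (uniformizedDist_two_le hY _ _).trans ?_
    rw [hFc, hFc]
    exact norm_bentSegment_sub_le ha hb s.2 t.2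
  have hFcont : Continuous F :=
    (LipschitzWith.of_dist_le_mul (K := (2 * r).toNNReal) fun s t => by
      rw [Real.coe_toNNReal _ (by positivity)]; exact hF s t).continuous
  let γ : Path x y :=
    { toFun := F
      continuous_toFun := hFcont
      source' := Uniformization.ext (toComplex_injective (by
        rw [hFc]; exact bentSegment_zero))
      target' := Uniformization.ext (toComplex_injective (by
        rw [hFc]; exact bentSegment_one)) }
  have hvar : ∀ {s t : unitInterval}, s ≤ t →
      eVariationOn γ (Icc s t) ≤ ENNReal.ofReal (2 * r * (t - s)) := fun h =>
    eVariationOn_Icc_le_of_lipschitz (by positivity) hF h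
  refine ⟨γ, ?_, fun s t hst => ?_⟩
  · have h := hvar (zero_le_one (α := unitInterval))
    rw [show Icc (0 : unitInterval) 1 = univ from Icc_bot_top] at h
    refine h.trans (ENNReal.ofReal_le_ofReal ?_)
    have := norm_sub_le_uniformizedDist_two hY x.point y.point
    rw [Uniformization.dist_eq]
    simp only [Icc.coe_one, Icc.coe_zero]
    linarith
  · have h1 := hvar (bot_le (a := s))
    have h2 := hvar (le_top (a := t))
    rw [Icc_bot] at h1
    rw [Icc_top] at h2
    have hst' : bentSegment a b s = bentSegment a b t := by
      rw [← hFc, ← hFc]; exact congrArg (fun p => p.point.toComplex) hst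
    have key := mul_min_le_of_bentSegment_eq ha hb s.2 t.2 hst'
    have hbd := le_boundaryDist_two (F s)
    rw [hFc] at hbd
    calc _ ≤ ENNReal.ofReal (64 : ℝ)⁻¹ *
          min (ENNReal.ofReal (2 * r * s)) (ENNReal.ofReal (2 * r * (1 - t))) := by
          gcongr
          · simpa using h1
          · simpa using h2
      _ = ENNReal.ofReal ((64 : ℝ)⁻¹ * (2 * r * min (s : ℝ) (1 - t))) := by
          rw [← ENNReal.ofReal_min, ← mul_min_of_nonneg _ _ (by positivity : 0 ≤ 2 * r),
            ← ENNReal.ofReal_mul (by norm_num)]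
      _ ≤ _ := by
          refine ENNReal.ofReal_le_ofReal ?_
          change _ ≤ boundaryDist (F s)
          linarith

end HypDisk

/-! ### Failure of uniformity for parameters above two. -/

lemma half_le_one_sub_exp_neg {u : ℝ} (h0 : 0 ≤ u) (h1 : u ≤ 1) :
    u / 2 ≤ 1 - Real.exp (-u) := by
  have h2 : Real.exp (-u) ≤ 1 / (1 + u) := by
    rw [Real.exp_neg, one_div]
    exact inv_anti₀ (by linarith) (by linarith [Real.add_one_le_exp u])
  have h3 : 1 / (1 + u) ≤ 1 - u / 2 := by
    rw [div_le_iff₀ (by linarith)]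
    nlinarith
  linarith

/-- On the set where the density is at least `m`, the uniformized length of a curve controls the
distance of its end points. -/
lemma edist_point_le_mul_eVariationOn {X : Type*} [MetricSpace X] {hX : IsGromovHyperbolic X}
    {z₀ : X} {ε : ℝ} (hε : 0 < ε) {x y : Uniformization hX z₀ ε} (γ : Path x y) {m : ℝ}
    (hm : 0 < m) (h : ∀ s, m ≤ uniformizationDensity z₀ ε (γ s).point) :
    edist x.point y.point ≤ ENNReal.ofReal (2 / m) * eVariationOn γ univ := by
  have huc : UniformContinuous fun s => (γ s).point :=
    CompactSpace.uniformContinuous_of_continuous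
      ((Uniformization.continuous_point hε).comp γ.continuous)
  -- The curve is cut into steps of hyperbolic length below `1 / ε`, where `1 - e^{-u} ≥ u / 2`
  -- linearizes `le_uniformizedDist`; this is the source of the factor `2 / m`.
  obtain ⟨δ, hδ, hδ'⟩ := Metric.uniformContinuous_iff.1 huc (1 / ε) (by positivity)
  obtain ⟨N, hN⟩ := exists_nat_one_div_lt hδ
  let u : ℕ → unitInterval := fun i => projIcc 0 1 zero_le_one ((i : ℝ) / ((N : ℝ) + 1))
  have hu : Monotone u := fun i j hij => monotone_projIcc _ (by gcongr)
  have hu0 : u 0 = 0 := by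
    refine (projIcc_of_le_left _ ?_)
    simp
  have hu1 : u (N + 1) = 1 := by
    refine (projIcc_of_right_le _ ?_)
    push_cast
    rw [div_self (by positivity)]
  have hstep : ∀ i, dist (u i) (u (i + 1)) < δ := fun i => by
    refine lt_of_le_of_lt ?_ hN
    rw [Subtype.dist_eq, Real.dist_eq]
    refine (abs_projIcc_sub_projIcc (h := zero_le_one)).trans ?_
    rw [← sub_div]
    push_cast
    rw [sub_add_cancel_left, abs_div, abs_neg, abs_one, abs_of_pos (by positivity)]
  have hloc : ∀ i, edist (γ (u i)).point (γ (u (i + 1))).point ≤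
      ENNReal.ofReal (2 / m) * edist (γ (u (i + 1))) (γ (u i)) := fun i => by
    rw [edist_dist, edist_dist, ← ENNReal.ofReal_mul (by positivity)]
    refine ENNReal.ofReal_le_ofReal ?_
    have h1 := hδ' (hstep i)
    rw [lt_div_iff₀' hε] at h1
    have h2 := hX.le_uniformizedDist z₀ hε (γ (u i)).point (γ (u (i + 1))).point
    have h3 := half_le_one_sub_exp_neg (u := ε * dist (γ (u i)).point (γ (u (i + 1))).point)
      (by positivity) h1.le
    rw [← neg_mul] at h3
    have h4 := mul_le_mul (h (u i)) h3 (by positivity) (uniformizationDensity_pos _ _ _).le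
    have h5 := h4.trans h2
    rw [dist_comm (γ (u (i + 1))), Uniformization.dist_eq, div_mul_eq_mul_div, le_div_iff₀ hm]
    refine le_of_mul_le_mul_left ?_ hε
    linarith
  calc edist x.point y.point = edist (γ (u 0)).point (γ (u (N + 1))).point := by
        rw [hu0, hu1, γ.source, γ.target]
    _ ≤ ∑ i ∈ Finset.range (N + 1), edist (γ (u i)).point (γ (u (i + 1))).point :=
        edist_le_range_sum_edist (fun i => (γ (u i)).point) (N + 1)
    _ ≤ ∑ i ∈ Finset.range (N + 1),
          ENNReal.ofReal (2 / m) * edist (γ (u (i + 1))) (γ (u i)) :=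
        Finset.sum_le_sum fun i _ => hloc i
    _ ≤ _ := by
        rw [← Finset.mul_sum]
        gcongr
        exact eVariationOn.sum_le hu fun _ => mem_univ _

/-- Along a uniform curve the density is bounded below by its smaller value at the end points. -/
lemma IsUniformCurve.density_le {X : Type*} [MetricSpace X] {hX : IsGromovHyperbolic X}
    {z₀ : X} {ε : ℝ} (hε : 0 < ε) {lam : ℝ} (hlam : 1 ≤ lam) {x y : Uniformization hX z₀ ε}
    {γ : Path x y} (hγ : IsUniformCurve lam γ)
    (hbd : ∀ z : Uniformization hX z₀ ε,
      boundaryDist z ≤ uniformizationDensity z₀ ε z.point / ε) (s : unitInterval) :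
    min (uniformizationDensity z₀ ε x.point) (uniformizationDensity z₀ ε y.point) ≤
      (1 + lam) * uniformizationDensity z₀ ε (γ s).point := by
  have hl : 0 < lam := by linarith
  have h1 : edist x (γ s) ≤ eVariationOn γ (Iic s) := by
    have := eVariationOn.edist_le γ (s := Iic s) (mem_Iic.2 bot_le : (0 : unitInterval) ∈ _)
      (mem_Iic.2 le_rfl)
    rwa [γ.source] at this
  have h2 : edist y (γ s) ≤ eVariationOn γ (Ici s) := by
    have := eVariationOn.edist_le γ (s := Ici s) (mem_Ici.2 le_top : (1 : unitInterval) ∈ _)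
      (mem_Ici.2 le_rfl)
    rwa [γ.target] at this
  have hρ := uniformizationDensity_pos z₀ ε (γ s).point
  -- Subcurves are at least as long as the distances of their end points, so the uniformity
  -- condition at `s = t` bounds the distance to the nearer end point by `λ ρ(γ s) / ε`. As `ρ` is
  -- `ε`-Lipschitz, its value at that end point is at most `(1 + λ) ρ(γ s)`.
  have h3 : ENNReal.ofReal (lam⁻¹ * min (dist x (γ s)) (dist y (γ s))) ≤
      ENNReal.ofReal (uniformizationDensity z₀ ε (γ s).point / ε) := by
    rw [ENNReal.ofReal_mul (by positivity), ENNReal.ofReal_min, ← edist_dist, ← edist_dist]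
    exact le_trans (by gcongr) ((hγ.2 s s rfl).trans (ENNReal.ofReal_le_ofReal (hbd _)))
  rw [ENNReal.ofReal_le_ofReal_iff (by positivity), inv_mul_le_iff₀ hl, mul_div_assoc',
    le_div_iff₀ hε] at h3
  have hx := hX.density_sub_le z₀ hε x.point (γ s).point
  have hy := hX.density_sub_le z₀ hε y.point (γ s).point
  rw [← Uniformization.dist_eq] at hx hy
  rcases min_cases (dist x (γ s)) (dist y (γ s)) with h | h
  · rw [h.1] at h3
    exact (min_le_left _ _).trans (by linarith)
  · rw [h.1] at h3
    exact (min_le_right _ _).trans (by linarith)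

namespace HypDisk

lemma cosh_le_exp {t : ℝ} (ht : 0 ≤ t) : Real.cosh t ≤ Real.exp t := by
  have := Real.sinh_nonneg_iff.2 ht
  linarith [Real.cosh_add_sinh t]

/-- Half of the circle of radius `T` is short in `Y_ε`. -/
lemma uniformizedDist_half_circle_le (hY : IsGromovHyperbolic HypDisk) {ε : ℝ} (hε : 0 ≤ ε)
    {T : ℝ} (hT : 0 ≤ T) :
    uniformizedDist 0 ε (polar 1 T) (polar (-1) T) ≤ Real.exp ((2 - ε) * T) * Real.pi := by
  have hn : ∀ θ : ℝ, ‖Complex.exp (Complex.I * θ)‖ = 1 := Complex.norm_exp_I_mul_ofReal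
  have h := uniformizedDist_le_of_curve hY hε (f := fun θ => polar (Complex.exp (Complex.I * θ)) T)
    (a := 0) (b := Real.pi) (K := 1) (M := Real.exp ((2 - ε) * T)) Real.pi_pos.le zero_le_one
    (fun s _ t _ => ?_) (fun θ _ => ?_)
  · have e0 : Complex.exp (Complex.I * (0 : ℝ)) = 1 := by simp
    have e1 : Complex.exp (Complex.I * (Real.pi : ℝ)) = -1 := by
      rw [mul_comm, Complex.exp_pi_mul_I]
    simp only [e0, e1] at h
    simpa using h
  · rw [toComplex_polar (hn s), toComplex_polar (hn t), ← mul_sub, norm_mul, Complex.norm_real,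
      Real.norm_eq_abs]
    have e : Complex.exp (Complex.I * s) - Complex.exp (Complex.I * t) =
        Complex.exp (Complex.I * t) * (Complex.exp (Complex.I * ((s - t : ℝ) : ℂ)) - 1) := by
      rw [mul_sub, ← Complex.exp_add, mul_one]
      congr 2
      push_cast
      ring
    rw [e, norm_mul, hn, one_mul]
    exact mul_le_mul (Real.abs_tanh_lt_one T).le Real.norm_exp_I_mul_ofReal_sub_one_le
      (norm_nonneg _) zero_le_one
  -- Since `1 - tanh² T = 1 / cosh² T` and `cosh T ≤ e^T`, the line element on the circle is at most
  -- `e^{(2-ε)T} |dz|`.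
  · have e : 1 - ‖(polar (Complex.exp (Complex.I * θ)) T).toComplex‖ ^ 2 =
        (Real.cosh T ^ 2)⁻¹ := by
      rw [toComplex_polar (hn θ), norm_mul, hn, mul_one, Complex.norm_real, Real.norm_eq_abs,
        sq_abs, Real.tanh_eq_sinh_div_cosh, div_pow, Real.sinh_sq]
      have := Real.cosh_pos T
      field_simp
      ring
    rw [e, density_polar (hn θ) hT, div_inv_eq_mul]
    calc _ ≤ Real.exp (-ε * T) * Real.exp T ^ 2 := by
          gcongr
          exact cosh_le_exp hT
      _ = _ := by
          rw [← Real.exp_nat_mul, ← Real.exp_add]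
          congr 1
          push_cast
          ring

/-- For `ε > 2`, antipodal points at distance `R` from the centre are joined in `Y_ε` by a curve
through the far part of the disk, whose length is comparable to their distance to the boundary. -/
lemma uniformizedDist_antipodal_le (hY : IsGromovHyperbolic HypDisk) {ε : ℝ} (hε : 2 < ε)
    {R : ℝ} (hR : 0 ≤ R) :
    uniformizedDist 0 ε (polar 1 R) (polar (-1) R) ≤ (2 / ε + 1) * Real.exp (-ε * R) := by
  have hε0 : 0 < ε := by linarith
  have hlim : Filter.Tendsto (fun T : ℝ => Real.exp ((2 - ε) * T) * Real.pi) Filter.atTop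
      (𝓝 0) := by
    simpa using (Real.tendsto_exp_atBot.comp
      (Filter.tendsto_id.const_mul_atTop_of_neg (by linarith : 2 - ε < 0))).mul_const Real.pi
  -- At this radius the half circle costs less than `e^{-εR}`; each of the two radial legs costs at
  -- most `e^{-εR} / ε`.
  obtain ⟨T, hT, hRT⟩ := ((hlim.eventually_lt_const (Real.exp_pos (-ε * R))).and
    (Filter.eventually_ge_atTop R)).exists
  have hray : ∀ u : ℂ, ‖u‖ = 1 →
      uniformizedDist 0 ε (polar u R) (polar u T) ≤ Real.exp (-ε * R) / ε := fun u hu =>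
    (uniformizedDist_polar_le hε0 hu hR hRT).trans
      (by gcongr; linarith [Real.exp_pos (-ε * T)])
  have h1 := hray 1 norm_one
  have h2 := uniformizedDist_half_circle_le hY hε0.le (hR.trans hRT)
  have h3 := hray (-1) (by simp)
  have h4 := dist_triangle4 (⟨polar 1 R⟩ : Uniformization hY 0 ε) ⟨polar 1 T⟩ ⟨polar (-1) T⟩
    ⟨polar (-1) R⟩
  rw [dist_comm (⟨polar (-1) T⟩ : Uniformization hY 0 ε)] at h4
  simp only [Uniformization.dist_eq] at h4
  have e : (2 / ε + 1) * Real.exp (-ε * R) =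
      Real.exp (-ε * R) / ε + Real.exp (-ε * R) + Real.exp (-ε * R) / ε := by ring
  linarith

theorem not_isUniformDomain (hY : IsGromovHyperbolic HypDisk) {ε : ℝ} (hε : 2 < ε) :
    ¬ IsUniformDomain (Uniformization hY 0 ε) := by
  intro hU
  have hε0 : 0 < ε := by linarith
  obtain ⟨lam, hlam, h⟩ := hU.uniform
  have hl : 0 < lam := by linarith
  -- The estimates below give `2R ≤ 2 (1 + λ) λ (2/ε + 1)`, in which all powers `e^{-εR}` have
  -- cancelled; this `R` just violates it.
  set R : ℝ := (1 + lam) * (lam * (2 / ε + 1)) + 1 with hR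
  have hR0 : 0 ≤ R := by positivity
  have hn : ‖(-1 : ℂ)‖ = 1 := by simp
  obtain ⟨γ, hγ⟩ := h ⟨polar 1 R⟩ ⟨polar (-1) R⟩
  have hp := Real.exp_pos (-ε * R)
  have hm : 0 < Real.exp (-ε * R) / (1 + lam) := by positivity
  have hρ : ∀ s, Real.exp (-ε * R) / (1 + lam) ≤ uniformizationDensity 0 ε (γ s).point :=
    fun s => by
      have := hγ.density_le hε0 hlam (boundaryDist_le hε0) s
      simp only [density_polar norm_one hR0, density_polar hn hR0, min_self] at this
      rwa [div_le_iff₀' (by positivity)]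
  have h1 := (edist_point_le_mul_eVariationOn hε0 γ hm hρ).trans (mul_le_mul_right hγ.1 _)
  have hpol : polar (-1) R = polar 1 (-R) := by simp [polar]
  have hd : dist (polar 1 R) (polar (-1) R) = 2 * R := by
    rw [hpol, dist_polar norm_one, sub_neg_eq_add, abs_of_nonneg (by positivity)]
    ring
  rw [edist_dist, ← ENNReal.ofReal_mul (by positivity), hd, Uniformization.dist_eq,
    ENNReal.ofReal_le_ofReal_iff'] at h1
  have h2 := uniformizedDist_antipodal_le hY hε hR0
  rcases h1 with h1 | h1
  · have h3 : 2 * R ≤ 2 * ((1 + lam) * (lam * (2 / ε + 1))) := by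
      calc 2 * R ≤ _ := h1
        _ ≤ 2 / (Real.exp (-ε * R) / (1 + lam)) *
            (lam * ((2 / ε + 1) * Real.exp (-ε * R))) := by gcongr
        _ = _ := by field_simp
    linarith
  -- The alternative `2R ≤ 0` arises only because `ENNReal.ofReal` truncates at zero.
  · have : 0 ≤ (1 + lam) * (lam * (2 / ε + 1)) := by positivity
    linarith

end HypDisk

/-! ### The counterexample. -/

theorem mainTheorem2 :
    -- the hyperbolic disk `Y` is Gromov hyperbolic
    (∃ hY : IsGromovHyperbolic HypDisk,
      -- some uniformization `Y_{ε₁}` is a uniform domain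
      (∃ ε₁ : ℝ, 0 < ε₁ ∧ IsUniformDomain (Uniformization hY 0 ε₁)) ∧
      -- for `ε > 2`, `Y_ε` is not a uniform domain
      (∀ ε : ℝ, 2 < ε → ¬ IsUniformDomain (Uniformization hY 0 ε)) ∧
      -- `Z` is the disk with the metric scaled by `ε₁ / ε`
      (∀ ε : ℝ, 2 < ε → ∀ ε₁ : ℝ, 0 < ε₁ → IsUniformDomain (Uniformization hY 0 ε₁) →
        ∃ (hc : 0 < ε₁ / ε) (hZ : IsGromovHyperbolic (Rescaled hc HypDisk)),
          -- `Z_ε` and `Y_{ε₁}` have the same points, and proportional metrics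
          (∀ z w : HypDisk,
            dist (⟨⟨z⟩⟩ : Uniformization hZ ⟨0⟩ ε) (⟨⟨w⟩⟩ : Uniformization hZ ⟨0⟩ ε) =
              ε₁ / ε * dist (⟨z⟩ : Uniformization hY 0 ε₁) (⟨w⟩ : Uniformization hY 0 ε₁)) ∧
          IsUniformDomain (Uniformization hZ ⟨0⟩ ε) ∧
          -- the identity map from `Y` to `Z`
          IsRoughSimilarity (ε₁ / ε) 0 (fun z : HypDisk => (⟨z⟩ : Rescaled hc HypDisk)))) ∧
    -- invariance of uniformity under rough isometries does not extend to rough similarities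
    ¬ ∀ (X Y : Type) [MetricSpace X] [MetricSpace Y]
        (hX : IsGromovHyperbolic X) (hY : IsGromovHyperbolic Y)
        (L C : ℝ) (Φ : Y → X), IsRoughSimilarity L C Φ →
        ∀ (y₀ : Y) (ε : ℝ), 0 < ε → IsUniformDomain (Uniformization hX (Φ y₀) ε) →
          IsUniformDomain (Uniformization hY y₀ ε) := by
  have hY := HypDisk.isGromovHyperbolic
  have rescale : ∀ ε : ℝ, 2 < ε → ∀ ε₁ : ℝ, 0 < ε₁ → IsUniformDomain (Uniformization hY 0 ε₁) →
      ∃ (hc : 0 < ε₁ / ε) (hZ : IsGromovHyperbolic (Rescaled hc HypDisk)),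
        (∀ z w : HypDisk,
          dist (⟨⟨z⟩⟩ : Uniformization hZ ⟨0⟩ ε) (⟨⟨w⟩⟩ : Uniformization hZ ⟨0⟩ ε) =
            ε₁ / ε * dist (⟨z⟩ : Uniformization hY 0 ε₁) (⟨w⟩ : Uniformization hY 0 ε₁)) ∧
        IsUniformDomain (Uniformization hZ ⟨0⟩ ε) ∧
        IsRoughSimilarity (ε₁ / ε) 0 (fun z : HypDisk => (⟨z⟩ : Rescaled hc HypDisk)) := by
    intro ε hε ε₁ hε₁ hU
    have hε0 : 0 < ε := by linarith
    have hc : 0 < ε₁ / ε := div_pos hε₁ hε0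
    have hd := Uniformization.dist_rescaledEquiv hY hc 0 (div_mul_cancel₀ ε₁ hε0.ne').symm
    exact ⟨hc, hY.rescaled hc, fun z w => hd ⟨z⟩ ⟨w⟩, hU.of_dilation _ hc hd,
      Rescaled.isRoughSimilarity hc⟩
  refine ⟨⟨hY, ⟨2, by norm_num, HypDisk.isUniformDomain_two hY⟩,
    fun ε hε => HypDisk.not_isUniformDomain hY hε, rescale⟩, fun hall => ?_⟩
  -- Here `Z` carries the metric `(2/3) d_Y`: `Z_3` is a scaled copy of the uniform domain `Y_2`,
  -- while `Y_3` is not uniform.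
  obtain ⟨hc, hZ, -, hU, hΦ⟩ := rescale 3 (by norm_num) 2 (by norm_num)
    (HypDisk.isUniformDomain_two hY)
  exact HypDisk.not_isUniformDomain hY (by norm_num : (2 : ℝ) < 3)
    (hall _ _ hZ hY _ _ _ hΦ 0 3 (by norm_num) hU)
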